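/- Let $n$ agents $N=\{1,\dots,n\}$ and $n$ items $o_1,\dots,o_n$ be given, with utilities $u_{ij}\in\{0,1\}$ of agent $i$ for item $o_j$, such that every item is liked ($u_{ij}=1$) by some agent and every agent likes some item. Let $D_i$ be the set of items most preferred by agent $i$. A \emph{fractional assignment} is a matrix $x\in[0,1]^{n\times n}$ with $\sum_i x_{ij}=1$ for every $j$; it is \emph{balanced} if also $\sum_j x_{ij}=1$ for every $i$. Agent $i$ has utility $u_i(x_i)=\sum_j u_{ij}x_{ij}$. Call a fractional assignment $x$: * an \emph{HZ solution} if it is balanced and there are prices $p\in\mathbb{R}_{\ge 0}^n$ such that for each $i$ the bundle $x_i$ maximizes $u_i$ among the bundles $b\in\mathbb{R}_{\ge0}^n$ with $\sum_j b_j=1$ and $\sum_j p_jb_j\le 1$, and $x_i$ has the least cost $\sum_j p_jb_j$ among the bundles $b\in\mathbb{R}_{\ge0}^n$ with $\sum_j b_j=1$ and $u_i(b)\ge u_i(x_i)$; * a \emph{CEEI solution} if the same holds with both requirements of being balanced dropped, that is, for a fractional assignment $x$ and all bundles $b\in\mathbb{R}_{\ge0}^n$ (no limit on the amounts demanded); *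 \emph{leximin} in a set $S$ of fractional assignments if $x\in S$ and there is no $y\in S$ whose utility vector, arranged in nondecreasing order, is lexicographically larger than that of $x$; * \emph{MNW} in $S$ if $x\in S$ maximizes $\prod_i u_i(x_i)$ over $S$; * \emph{egalitarian} (Bogomolnaia--Moulin) if $x$ is the random assignment given by a lottery over perfect matchings of agents with items for which the vector of the agents' probabilities of being matched to an acceptable item (one in $D_i$) is leximin optimal among all such lotteries; * an \emph{EPS outcome} if it is obtained as follows. Start with all agents $N'$ and all items $O'$. While $N'\ne\emptyset$: if all agents $i\in N'$ can simultaneously get one unit of items of $D_i\cap O'$, give them so and let them all leave; otherwise let $X\subseteq N'$ be a largest nonempty set minimizing $|\bigcup_{i\in X}(D_i\cap O')|/|X|$, let $v$ be this minimum, share the items $\bigcup_{i\in X}(D_i\cap O')$ among the agents of $X$ so that each $i\in X$ gets the amount $v$ of items of $D_i\cap O'$, and remove these agents and items. In the end give what is left of the items to the agents with less than one unit, so that the assignment becomes balanced. The \emph{balancing operation} turns a fractional assignment $x$ into a balanced one: every agent with more than one unit gives away least preferred items until she holds one unit, agents with exactly one unit keep their allocations, and the donated amounts are distributed arbitrarily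 to the agents with less than one unit so that everyone holds one unit. \textbf{Theorem.} Under these assumptions there is a single utility vector $v\in\mathbb{R}^n$ such that each of the following eight rules has at least one outcome, and every outcome of each of them gives every agent $i$ the utility $v_i$: (1) the HZ rule; (2) the EPS rule; (3) the egalitarian rule of Bogomolnaia and Moulin; (4) leximin in the set of balanced assignments; (5) MNW in the set of balanced assignments; (6) the balancing operation applied to a leximin solution in the set of all fractional assignments; (7) the balancing operation applied to an MNW solution in the set of all fractional assignments; (8) the balancing operation applied to a CEEI solution. -/

import Mathlib

namespace RandomAssignment

/-- A matrix indexed by agents (rows) and items (columns): entry `x i j` is the amount of item `j`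
given to agent `i`. Utility profiles have the same shape: `u i j` is the utility of agent `i`
for item `j`. -/
abbrev Mat (n : ℕ) := Matrix (Fin n) (Fin n) ℝ

/-- Fractional assignments: entries in `[0,1]`, and every item is completely allocated. -/
def assignments (n : ℕ) : Set (Mat n) :=
  {x | (∀ i j, 0 ≤ x i j ∧ x i j ≤ 1) ∧ ∀ j, ∑ i, x i j = 1}

/-- Balanced fractional assignments: moreover every agent gets exactly one unit of items. -/
def balancedAssignments (n : ℕ) : Set (Mat n) :=
  {x | x ∈ assignments n ∧ ∀ i, ∑ j, x i j = 1}

/-- Additive utility of a bundle `b` of items, for an agent with item utilities `a`. -/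
def bundleUtility {n : ℕ} (a b : Fin n → ℝ) : ℝ := ∑ j, b j * a j

/-- The utilities of the agents in the assignment `x`. -/
def utilities {n : ℕ} (u x : Mat n) : Fin n → ℝ := fun i => bundleUtility (u i) (x i)

/-- The cost of the bundle `b` at prices `p`. -/
def cost {n : ℕ} (p b : Fin n → ℝ) : ℝ := ∑ j, p j * b j

/-- The set `D_i` of items most preferred by agent `i`. -/
noncomputable def favourites {n : ℕ} (u : Mat n) (i : Fin n) : Finset (Fin n) :=
  Finset.univ.filter fun j => ∀ k, u i k ≤ u i j

/-! ### Pseudo-market rules -/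

/-- Bundles of divisible items, without any limit on the amounts. -/
def bundles (n : ℕ) : Set (Fin n → ℝ) := {b | ∀ j, 0 ≤ b j}

/-- Bundles of total size one. -/
def balancedBundles (n : ℕ) : Set (Fin n → ℝ) := {b | (∀ j, 0 ≤ b j) ∧ ∑ j, b j = 1}

/-- `b` is a cheapest utility-maximising bundle in the consumption set `B`, for an agent with item
utilities `a` and budget `1` facing prices `p`. -/
def IsCheapestDemand {n : ℕ} (B : Set (Fin n → ℝ)) (a p b : Fin n → ℝ) : Prop :=
  (b ∈ B ∧ cost p b ≤ 1 ∧ ∀ b' ∈ B, cost p b' ≤ 1 → bundleUtility a b' ≤ bundleUtility a b) ∧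
  IsLeast {c | ∃ y ∈ B, bundleUtility a b ≤ bundleUtility a y ∧ c = cost p y} (cost p b)

/-- Hylland-Zeckhauser solutions. -/
def IsHZ {n : ℕ} (u x : Mat n) : Prop :=
  x ∈ balancedAssignments n ∧
    ∃ p : Fin n → ℝ, (∀ j, 0 ≤ p j) ∧ ∀ i, IsCheapestDemand (balancedBundles n) (u i) p (x i)

/-- Competitive equilibria with equal incomes. -/
def IsCEEI {n : ℕ} (u x : Mat n) : Prop :=
  x ∈ assignments n ∧
    ∃ p : Fin n → ℝ, (∀ j, 0 ≤ p j) ∧ ∀ i, IsCheapestDemand (bundles n) (u i) p (x i)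

/-! ### Welfare-maximising rules, over a set `S` of admissible assignments -/

/-- The entries of `v` in nondecreasing order. -/
noncomputable def sorted {n : ℕ} (v : Fin n → ℝ) : Fin n → ℝ := v ∘ Tuple.sort v

/-- Leximin dominance: at the first place where the vectors, each arranged in nondecreasing order,
differ, `v` is larger than `w`. -/
def LeximinDominates {n : ℕ} (v w : Fin n → ℝ) : Prop :=
  ∃ i, (∀ j < i, sorted v j = sorted w j) ∧ sorted w i < sorted v i

/-- `x` is leximin optimal in `S`. -/
def IsLeximin {n : ℕ} (S : Set (Mat n)) (u x : Mat n) : Prop :=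
  x ∈ S ∧ ¬ ∃ y ∈ S, LeximinDominates (utilities u y) (utilities u x)

/-- `x` maximises Nash welfare, the product of the utilities, in `S`. -/
def IsMNW {n : ℕ} (S : Set (Mat n)) (u x : Mat n) : Prop :=
  x ∈ S ∧ ∀ y ∈ S, ∏ i, utilities u y i ≤ ∏ i, utilities u x i

/-! ### The egalitarian rule on random matchings -/

/-- The random assignment induced by a lottery `w` over perfect matchings of agents with items. -/
def ofLottery {n : ℕ} (w : Equiv.Perm (Fin n) → ℝ) : Mat n :=
  fun i j => ∑ σ, if σ i = j then w σ else 0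

/-- The probabilities with which the agents are matched to acceptable (most preferred) items. -/
noncomputable def acceptableProb {n : ℕ} (u : Mat n) (w : Equiv.Perm (Fin n) → ℝ) : Fin n → ℝ :=
  fun i => ∑ σ, if σ i ∈ favourites u i then w σ else 0

/-- `x` is the outcome of a lottery over perfect matchings for which the agents' probabilities of
an acceptable match are leximin optimal among all such lotteries. -/
def IsEgalitarian {n : ℕ} (u x : Mat n) : Prop :=
  ∃ w ∈ stdSimplex ℝ (Equiv.Perm (Fin n)), x = ofLottery w ∧
    ¬ ∃ w' ∈ stdSimplex ℝ (Equiv.Perm (Fin n)),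
      LeximinDominates (acceptableProb u w') (acceptableProb u w)

/-! ### Extended probabilistic serial -/

/-- The items of `P` that are most preferred by some agent of `C`. -/
noncomputable def likedBy {n : ℕ} (u : Mat n) (C P : Finset (Fin n)) : Finset (Fin n) :=
  C.biUnion fun i => favourites u i ∩ P

/-- `z` gives each agent `i ∈ X` an amount `v` of items from `D_i ∩ P`, and nothing else, without
using more than one unit of any item. -/
def GivesAmount {n : ℕ} (u : Mat n) (X P : Finset (Fin n)) (v : ℝ) (z : Mat n) : Prop :=
  (∀ i j, 0 ≤ z i j) ∧ (∀ i j, z i j ≠ 0 → i ∈ X ∧ j ∈ favourites u i ∩ P) ∧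
    (∀ i ∈ X, ∑ j, z i j = v) ∧ ∀ j, ∑ i, z i j ≤ 1

/-- `|⋃_{i ∈ C} (D_i ∩ P)| / |C|`. -/
noncomputable def ratio {n : ℕ} (u : Mat n) (P C : Finset (Fin n)) : ℝ :=
  ((likedBy u C P).card : ℝ) / (C.card : ℝ)

/-- `X` minimises the ratio among the nonempty sets of remaining agents. -/
def MinimisesRatio {n : ℕ} (u : Mat n) (A P X : Finset (Fin n)) : Prop :=
  X ⊆ A ∧ X.Nonempty ∧ ∀ C ⊆ A, C.Nonempty → ratio u P X ≤ ratio u P C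

/-- `X` is a bottleneck set: a minimiser of the ratio of largest cardinality. -/
def IsBottleneck {n : ℕ} (u : Mat n) (A P X : Finset (Fin n)) : Prop :=
  MinimisesRatio u A P X ∧ ∀ Y, MinimisesRatio u A P Y → Y.card ≤ X.card

/-- `EPSLoop u A P x`: the while-loop of the algorithm, started with remaining agents `A` and
remaining items `P`, can finalise the partial assignment `x` for the agents in `A`. -/
inductive EPSLoop {n : ℕ} (u : Mat n) : Finset (Fin n) → Finset (Fin n) → Mat n → Prop
  /-- There is no agent left. -/
  | done (P : Finset (Fin n)) : EPSLoop u ∅ P 0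
  /-- Each remaining agent can get, and is given, one unit of liked remaining items. -/
  | unit (A P : Finset (Fin n)) (z : Mat n) (hA : A.Nonempty) (hz : GivesAmount u A P 1 z) :
      EPSLoop u A P z
  /-- Otherwise the agents of a bottleneck set `X` are served and leave with the items they like. -/
  | bottleneck (A P X : Finset (Fin n)) (z x : Mat n) (hA : A.Nonempty)
      (hunit : ¬ ∃ y, GivesAmount u A P 1 y) (hX : IsBottleneck u A P X)
      (hz : GivesAmount u X (likedBy u X P) (ratio u P X) z)
      (hx : EPSLoop u (A \ X) (P \ likedBy u X P) x) :
      EPSLoop u A P (z + x)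

/-- Outcomes of the extended probabilistic serial rule: after the loop has produced the partial
assignment `y`, what is left of the items is handed to the agents holding less than one unit so
that every agent ends up with one unit. -/
def IsEPS {n : ℕ} (u x : Mat n) : Prop :=
  ∃ y, EPSLoop u Finset.univ Finset.univ y ∧ x ∈ balancedAssignments n ∧
    (∀ i j, y i j ≤ x i j) ∧ ∀ i, ¬ ∑ j, y i j < 1 → x i = y i

/-! ### The balancing operation -/

/-- `y` can result from applying the balancing operation to `x`: an agent holding more than one unit
gives away least preferred items until one unit is left; an agent holding less than one unit is
filled up to one unit with donated items; all others keep their bundles. (All that is donated is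
handed out again since `y` is an assignment.) -/
def IsBalancingOf {n : ℕ} (u x y : Mat n) : Prop :=
  y ∈ balancedAssignments n ∧
  (∀ i, 1 < ∑ j, x i j →
    (∀ j, y i j ≤ x i j) ∧ ∀ j k, u i j < u i k → y i k < x i k → y i j = 0) ∧
  (∀ i, ∑ j, x i j < 1 → ∀ j, x i j ≤ y i j) ∧
  (∀ i, ∑ j, x i j = 1 → y i = x i)

/-- The rule that applies the balancing operation to an outcome of the rule `R`. -/
def ThenBalance {n : ℕ} (R : Mat n → Mat n → Prop) (u y : Mat n) : Prop :=
  ∃ x, R u x ∧ IsBalancingOf u x y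

/-- The utility profiles that the outcomes of the rule `R` give to the agents. -/
def profiles {n : ℕ} (R : Mat n → Mat n → Prop) (u : Mat n) : Set (Fin n → ℝ) :=
  utilities u '' {x | R u x}

end RandomAssignment

open RandomAssignment

/-! All eight rules are reduced to one notion, `IsFair c u x`: whenever an agent has utility below
the cap `c`, every item she likes is fully held by agents who like it and are no better off than she
is. The cap is 1 for balanced assignments, where no utility exceeds 1, and `n + 1` for arbitrary
assignments, where utilities are at most `n` and the cap never binds.

Fairness implies a form of majorization. The agents below the cap with utility at most `t` jointly
own, without waste, every item that one of them likes, so no other assignment gives them more in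
total; agents at the cap cannot do better either (`IsFair.sublevelGE`). Such domination over all
sublevel sets makes a vector leximin larger than every different competitor, and strictly larger in
product when its entries are positive. Hence fair assignments share one utility vector, and fair,
leximin and MNW coincide, both with and without balancedness.

In a market equilibrium, an agent envying the holder of an item she likes could afford to imitate
the liked part of the holder's bundle; conversely, pricing each item at the inverse utility of its
poorest fan supports a fair assignment. The serial loop serves bottleneck sets in order of
increasing ratio, which is fairness; existence comes from it and a fractional Hall theorem.
Balancing an uncapped fair assignment leaves the items liked by agents below 1 untouched, so
fairness with cap 1 survives (`IsFair.transfer`). Finally, Birkhoff's theorem identifies lotteries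
over perfect matchings with balanced assignments. -/

namespace RandomAssignment

/-! ### Majorization: sublevel sums and products -/

section Majorization

variable {ι : Type*}

/-- If all the partial sums of `d` over sublevel sets of `f` are nonnegative, then so is the sum of
`d` weighted by a nonnegative antitone function of `f`. -/
theorem sum_mul_nonneg_of_sublevel {f d : ι → ℝ} (s : Finset ι) :
    ∀ w : ι → ℝ, (∀ i ∈ s, 0 ≤ w i) → (∀ i ∈ s, ∀ j ∈ s, f i ≤ f j → w j ≤ w i) →
    (∀ t, 0 ≤ ∑ i ∈ s with f i ≤ t, d i) → 0 ≤ ∑ i ∈ s, d i * w i := by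
  induction s using Finset.strongInduction with
  | H s ih =>
    intro w hw hanti hd
    rcases s.eq_empty_or_nonempty with rfl | hs
    · simp
    obtain ⟨m, hm, hmax⟩ := s.exists_max_image f hs
    have hsub : s.filter (fun i => f i < f m) ⊂ s :=
      Finset.filter_ssubset.2 ⟨m, hm, lt_irrefl _⟩
    -- Abel summation: peel off the top level of `f` and subtract its weight, the smallest one, from
    -- all the others, which stay nonnegative and antitone.
    have key := ih _ hsub (fun i => w i - w m)
      (fun i hi => by
        have hi' := (Finset.mem_filter.1 hi)
        have := hanti i hi'.1 m hm hi'.2.le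
        linarith)
      (fun i hi j hj hij => by
        have := hanti i (Finset.mem_filter.1 hi).1 j (Finset.mem_filter.1 hj).1 hij
        linarith)
      (fun t => by
        rw [Finset.filter_filter]
        by_cases ht : t < f m
        · convert hd t using 2
          ext i
          simp only [Finset.mem_filter]
          exact ⟨fun h => ⟨h.1, h.2.2⟩, fun h => ⟨h.1, h.2.trans_lt ht, h.2⟩⟩
        · push Not at ht
          -- The strict sublevel set below `f m` is the sublevel set at the largest value of `f`
          -- below `f m`, where the hypothesis applies.
          by_cases hlow : (s.filter fun i => f i < f m).Nonempty
          · obtain ⟨l, hl, hlmax⟩ := Finset.exists_max_image _ f hlow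
            convert hd (f l) using 2
            ext i
            simp only [Finset.mem_filter] at hl hlmax ⊢
            exact ⟨fun h => ⟨h.1, hlmax i ⟨h.1, h.2.1⟩⟩,
              fun h => ⟨h.1, h.2.trans_lt hl.2, (h.2.trans hl.2.le).trans ht⟩⟩
          · rw [Finset.not_nonempty_iff_eq_empty] at hlow
            rw [← Finset.filter_filter, hlow]
            simp)
    have hall : 0 ≤ ∑ i ∈ s, d i := by
      have := hd (f m)
      rwa [Finset.filter_true_of_mem hmax] at this
    have hsplit : ∑ i ∈ s, d i * w i =
        ∑ i ∈ s with f i < f m, d i * (w i - w m) + (∑ i ∈ s, d i) * w m := by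
      rw [Finset.sum_filter, Finset.sum_mul, ← Finset.sum_add_distrib]
      refine Finset.sum_congr rfl fun i hi => ?_
      split_ifs with h
      · ring
      · have hle : f m ≤ f i := not_lt.1 h
        have h1 := hanti m hm i hi hle
        have h2 := hanti i hi m hm (hmax i hi)
        rw [le_antisymm h1 h2]; ring
    rw [hsplit]
    exact add_nonneg key (mul_nonneg hall (hw m hm))

variable [Fintype ι]

/-- `f` weakly exceeds `g` in total over every sublevel set of `f`. -/
def SublevelGE (f g : ι → ℝ) : Prop :=
  ∀ t, ∑ i with f i ≤ t, g i ≤ ∑ i with f i ≤ t, f i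

/-- The weights `1 / f i` are positive and decreasing in `f i`, so the weighted sum of `f - g` is
nonnegative. -/
theorem SublevelGE.sum_div_le {f g : ι → ℝ} (h : SublevelGE f g) (hf : ∀ i, 0 < f i) :
    ∑ i, (g i / f i - 1) ≤ 0 := by
  have := sum_mul_nonneg_of_sublevel (f := f) (d := fun i => f i - g i) Finset.univ
    (fun i => (f i)⁻¹) (fun i _ => (inv_pos.2 (hf i)).le)
    (fun i _ j _ hij => inv_anti₀ (hf i) hij)
    (fun t => by rw [Finset.sum_sub_distrib]; exact sub_nonneg.2 (h t))
  have h2 : ∑ i, (g i / f i - 1) = -∑ i, (f i - g i) * (f i)⁻¹ := by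
    rw [← Finset.sum_neg_distrib]
    refine Finset.sum_congr rfl fun i _ => ?_
    have := (hf i).ne'
    field_simp
    ring
  rw [h2]; linarith

/-- Apply `log r ≤ r - 1` to the ratios `r = g i / f i`; it is strict unless `r = 1`, while the
right-hand sides sum to at most 0. -/
theorem SublevelGE.eq_of_prod_le {f g : ι → ℝ} (h : SublevelGE f g) (hf : ∀ i, 0 < f i)
    (hg : ∀ i, 0 ≤ g i) (hprod : ∏ i, f i ≤ ∏ i, g i) : g = f := by
  have hpos : 0 < ∏ i, g i := (Finset.prod_pos fun i _ => hf i).trans_le hprod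
  have hg' : ∀ i, 0 < g i := fun i => (hg i).lt_of_ne fun h0 =>
    hpos.ne' (Finset.prod_eq_zero (Finset.mem_univ i) h0.symm)
  have hlog : 0 ≤ ∑ i, Real.log (g i / f i) := by
    rw [← Real.log_prod (fun i _ => (div_pos (hg' i) (hf i)).ne')]
    refine Real.log_nonneg ?_
    rw [Finset.prod_div_distrib, one_le_div (Finset.prod_pos fun i _ => hf i)]
    exact hprod
  by_contra hne
  obtain ⟨i, hi⟩ := Function.ne_iff.1 hne
  have : ∑ i, Real.log (g i / f i) < ∑ i, (g i / f i - 1) := by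
    refine Finset.sum_lt_sum
      (fun i _ => Real.log_le_sub_one_of_pos (div_pos (hg' i) (hf i))) ⟨i, Finset.mem_univ i, ?_⟩
    refine Real.log_lt_sub_one_of_pos (div_pos (hg' i) (hf i)) ?_
    rwa [Ne, div_eq_one_iff_eq (hf i).ne']
  linarith [h.sum_div_le hf]

theorem SublevelGE.prod_le {f g : ι → ℝ} (h : SublevelGE f g) (hf : ∀ i, 0 < f i)
    (hg : ∀ i, 0 ≤ g i) : ∏ i, g i ≤ ∏ i, f i := by
  by_contra hlt
  push Not at hlt
  rw [h.eq_of_prod_le hf hg hlt.le] at hlt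
  exact lt_irrefl _ hlt

end Majorization

/-! ### Leximin comparison of sorted vectors -/

section Leximin

variable {n : ℕ}

/-- Turns entries of a sorted vector into cardinalities of sublevel sets, so that the sorting
permutation need not be handled again. -/
theorem sorted_le_iff (v : Fin n → ℝ) (j : Fin n) (s : ℝ) :
    sorted v j ≤ s ↔ (j : ℕ) < (Finset.univ.filter fun i => v i ≤ s).card := by
  have hmono : Monotone (sorted v) := Tuple.monotone_sort v
  rw [← Tuple.lt_card_le_iff_apply_le_of_monotone hmono]
  have : (Finset.univ.filter fun i => sorted v i ≤ s).card =
      (Finset.univ.filter fun i => v i ≤ s).card := by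
    refine Finset.card_equiv (Tuple.sort v) fun i => ?_
    rw [Finset.mem_filter, Finset.mem_filter]
    simp [sorted]
  rw [this]

theorem LeximinDominates.asymm {v w : Fin n → ℝ} (h : LeximinDominates v w) :
    ¬ LeximinDominates w v := by
  rintro ⟨j, hj, hj'⟩
  obtain ⟨i, hi, hi'⟩ := h
  rcases lt_trichotomy i j with hij | rfl | hij
  · rw [hj i hij] at hi'; exact lt_irrefl _ hi'
  · exact lt_asymm hi' hj'
  · rw [hi j hij] at hj'; exact lt_irrefl _ hj'

theorem SublevelGE.leximinDominates {f g : Fin n → ℝ} (h : SublevelGE f g) (hne : g ≠ f) :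
    LeximinDominates f g := by
  obtain ⟨i₀, hi₀⟩ := Function.ne_iff.1 hne
  -- a deviating position at the lowest possible level of `f`
  obtain ⟨a, ha, hamin⟩ := (Finset.univ.filter fun i => g i ≠ f i).exists_min_image f
    ⟨i₀, by simpa using hi₀⟩
  obtain ⟨b, hb, hbmin⟩ := (Finset.univ.filter fun i => g i ≠ f i).exists_min_image g
    ⟨i₀, by simpa using hi₀⟩
  simp only [Finset.mem_filter, Finset.mem_univ, true_and] at ha hamin hb hbmin
  have hlt : g b < f a := by
    by_contra hge
    -- Otherwise, on the sublevel set of `f` at `f a`, every deviating entry has `f i ≤ f a ≤ g b ≤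
    -- g i`, strictly at `a`, so `g` has the larger sum there.
    push Not at hge
    refine absurd (h (f a)) (not_le.2 (Finset.sum_lt_sum (fun i hi => ?_) ⟨a, by simp, ?_⟩))
    · by_cases hi' : g i = f i
      · exact hi'.ge
      · exact ((Finset.mem_filter.1 hi).2.trans hge).trans (hbmin i hi')
    · exact (hge.trans (hbmin a ha)).lt_of_ne' ha
  have hle : ∀ i, f i ≤ g b → g i = f i := fun i hi => by
    by_contra hi'
    exact absurd (hamin i hi') (not_le.2 (hi.trans_lt hlt))
  have hle' : ∀ i, g i < g b → g i = f i := fun i hi => by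
    by_contra hi'
    exact absurd (hbmin i hi') (not_le.2 hi)
  -- The sorted vectors first differ at position `k` (counted from 0): strictly below level `g b`
  -- the sublevel sets agree, and at `g b` the one of `g` gains `b`.
  set k := (Finset.univ.filter fun i => f i ≤ g b).card with hk
  have hcard : k < (Finset.univ.filter fun i => g i ≤ g b).card := by
    refine Finset.card_lt_card (Finset.ssubset_iff_of_subset ?_ |>.2 ⟨b, by simp, ?_⟩)
    · intro i hi
      simp only [Finset.mem_filter, Finset.mem_univ, true_and] at hi ⊢
      rw [hle i hi]; exact hi
    · simp only [Finset.mem_filter, Finset.mem_univ, true_and]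
      exact fun h' => hb (hle b h')
  have hkn : k < n := hcard.trans_le ((Finset.card_le_univ _).trans_eq (Fintype.card_fin n))
  refine ⟨⟨k, hkn⟩, fun j hj => ?_, ?_⟩
  · have hj' : (j : ℕ) < k := hj
    have h1 : sorted f j ≤ g b := (sorted_le_iff _ _ _).2 hj'
    have h2 : sorted g j ≤ g b := (sorted_le_iff _ _ _).2 (hj'.trans hcard)
    refine eq_of_forall_ge_iff fun s => ?_
    by_cases hs : g b ≤ s
    · exact iff_of_true (h1.trans hs) (h2.trans hs)
    · push Not at hs
      rw [sorted_le_iff, sorted_le_iff]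
      have : (Finset.univ.filter fun i => f i ≤ s) = Finset.univ.filter fun i => g i ≤ s := by
        ext i
        simp only [Finset.mem_filter, Finset.mem_univ, true_and]
        refine ⟨fun hi => ?_, fun hi => ?_⟩
        · rwa [hle i (hi.trans hs.le)]
        · rwa [← hle' i (hi.trans_lt hs)]
      rw [this]
  · have h1 : ¬ sorted f ⟨k, hkn⟩ ≤ g b := by
      rw [sorted_le_iff]; exact lt_irrefl _
    have h2 : sorted g ⟨k, hkn⟩ ≤ g b := (sorted_le_iff _ _ _).2 hcard
    exact h2.trans_lt (not_le.1 h1)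

end Leximin

/-! ### Fair assignments and their majorization property -/

section Fairness

variable {n : ℕ} {u x y : Mat n} {c : ℝ}

/-- Utilities are zero or one. -/
def Binary (u : Mat n) : Prop := ∀ i j, u i j = 0 ∨ u i j = 1

theorem Binary.nonneg (hu : Binary u) (i j : Fin n) : 0 ≤ u i j := by
  rcases hu i j with h | h <;> simp [h]

theorem Binary.le_one (hu : Binary u) (i j : Fin n) : u i j ≤ 1 := by
  rcases hu i j with h | h <;> simp [h]

theorem Binary.mul_nonneg (hu : Binary u) (hx : ∀ i j, 0 ≤ x i j) (i j : Fin n) :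
    0 ≤ x i j * u i j := _root_.mul_nonneg (hx i j) (hu.nonneg i j)

theorem Binary.mul_le (hu : Binary u) (hx : ∀ i j, 0 ≤ x i j) (i j : Fin n) :
    x i j * u i j ≤ x i j := mul_le_of_le_one_right (hx i j) (hu.le_one i j)

theorem utilities_apply (u x : Mat n) (i : Fin n) : utilities u x i = ∑ j, x i j * u i j := rfl

theorem utilities_nonneg (hu : Binary u) (hx : ∀ i j, 0 ≤ x i j) (i : Fin n) :
    0 ≤ utilities u x i := by
  rw [utilities_apply]
  exact Finset.sum_nonneg fun j _ => hu.mul_nonneg hx i j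

theorem utilities_le_sum (hu : Binary u) (hx : ∀ i j, 0 ≤ x i j) (i : Fin n) :
    utilities u x i ≤ ∑ j, x i j := by
  rw [utilities_apply]
  exact Finset.sum_le_sum fun j _ => hu.mul_le hx i j

theorem utilities_eq_sum (hu : Binary u) (i : Fin n) (h : ∀ j, u i j = 0 → x i j = 0) :
    utilities u x i = ∑ j, x i j := by
  rw [utilities_apply]
  refine Finset.sum_congr rfl fun j _ => ?_
  rcases hu i j with h0 | h0
  · simp [h0, h j h0]
  · simp [h0]

theorem le_utilities (hu : Binary u) (hx : ∀ i j, 0 ≤ x i j) {i j : Fin n} (hij : u i j = 1) :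
    x i j ≤ utilities u x i := by
  have := Finset.single_le_sum (f := fun j => x i j * u i j)
    (fun j _ => hu.mul_nonneg hx i j) (Finset.mem_univ j)
  simpa [hij, utilities_apply] using this

/-- An agent whose utility is below the cap `c` envies nobody holding items she likes: these items
are completely allocated to agents who like them and who have at most her utility. -/
def IsFair (c : ℝ) (u x : Mat n) : Prop :=
  (∀ i j, 0 ≤ x i j) ∧ ∀ i j, u i j = 1 → utilities u x i < c →
    ∑ k, x k j = 1 ∧ ∀ k, 0 < x k j → u k j = 1 ∧ utilities u x k ≤ utilities u x i

/-- The total utility of a set of agents who get all items that they like. -/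
theorem sum_utilities_eq (hu : Binary u) (A L : Finset (Fin n))
    (hL : ∀ i ∈ A, ∀ j, u i j = 1 → j ∈ L) :
    ∑ i ∈ A, utilities u y i = ∑ j ∈ L, ∑ i ∈ A, y i j * u i j := by
  rw [Finset.sum_comm]
  refine Finset.sum_congr rfl fun i hi => ?_
  refine (Finset.sum_subset (Finset.subset_univ L) fun j _ hj => ?_).symm
  rcases hu i j with h | h
  · simp [h]
  · exact absurd (hL i hi j h) hj

theorem column_le_one (hu : Binary u) (hy : ∀ i j, 0 ≤ y i j) (hcol : ∀ j, ∑ i, y i j ≤ 1)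
    (A : Finset (Fin n)) (j : Fin n) : ∑ i ∈ A, y i j * u i j ≤ 1 :=
  ((Finset.sum_le_sum fun i _ => hu.mul_le hy i j).trans
    (Finset.sum_le_univ_sum_of_nonneg fun i => hy i j)).trans (hcol j)

/-- The items liked by some agent of `A`. -/
noncomputable def likedSet (u : Mat n) (A : Finset (Fin n)) : Finset (Fin n) :=
  Finset.univ.filter fun j => ∃ i ∈ A, u i j = 1

theorem mem_likedSet {A : Finset (Fin n)} {j : Fin n} :
    j ∈ likedSet u A ↔ ∃ i ∈ A, u i j = 1 := by simp [likedSet]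

/-- The agents below the cap whose utility is at most `t`. -/
noncomputable def poorAgents (c : ℝ) (u x : Mat n) (t : ℝ) : Finset (Fin n) :=
  Finset.univ.filter fun i => utilities u x i ≤ t ∧ utilities u x i < c

theorem mem_poorAgents {t : ℝ} {i : Fin n} :
    i ∈ poorAgents c u x t ↔ utilities u x i ≤ t ∧ utilities u x i < c := by simp [poorAgents]

/-- By fairness, all holders of an item liked by a poor agent are themselves poor at the same level
and like the item. -/
theorem IsFair.column_eq_one (hx : IsFair c u x) (t : ℝ) {j : Fin n}
    (hj : j ∈ likedSet u (poorAgents c u x t)) :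
    ∑ i ∈ poorAgents c u x t, x i j * u i j = 1 := by
  obtain ⟨i, hi, hij⟩ := mem_likedSet.1 hj
  rw [mem_poorAgents] at hi
  obtain ⟨h1, h2⟩ := hx.2 i j hij hi.2
  have hpos : ∀ k, x k j ≠ 0 → k ∈ poorAgents c u x t ∧ u k j = 1 := fun k hk => by
    obtain ⟨h3, h4⟩ := h2 k ((hx.1 k j).lt_of_ne' hk)
    exact ⟨mem_poorAgents.2 ⟨h4.trans hi.1, h4.trans_lt hi.2⟩, h3⟩
  rw [← h1]
  refine (Finset.sum_congr rfl fun k _ => ?_).trans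
    (Finset.sum_subset (Finset.subset_univ _) fun k _ hk => ?_)
  · by_cases h0 : x k j = 0
    · simp [h0]
    · simp [(hpos k h0).2]
  · by_contra h0
    exact hk (hpos k h0).1

theorem IsFair.sum_poorAgents (hu : Binary u) (hx : IsFair c u x) (t : ℝ) :
    ∑ i ∈ poorAgents c u x t, utilities u x i =
      ∑ _j ∈ likedSet u (poorAgents c u x t), (1 : ℝ) := by
  rw [sum_utilities_eq hu _ _ fun i hi j hij => mem_likedSet.2 ⟨i, hi, hij⟩]
  exact Finset.sum_congr rfl fun _ hj => hx.column_eq_one t hj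

/-- A fair assignment majorises every other one respecting the cap. -/
theorem IsFair.sublevelGE (hu : Binary u) (hx : IsFair c u x) (hy : ∀ i j, 0 ≤ y i j)
    (hcol : ∀ j, ∑ i, y i j ≤ 1) (hcap : ∀ i, utilities u y i ≤ c) :
    SublevelGE (utilities u x) (utilities u y) := by
  intro t
  have hpoor : ∑ i ∈ poorAgents c u x t, utilities u y i ≤
      ∑ i ∈ poorAgents c u x t, utilities u x i := by
    rw [hx.sum_poorAgents hu,
      sum_utilities_eq hu _ _ fun i hi j hij => mem_likedSet.2 ⟨i, hi, hij⟩]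
    exact Finset.sum_le_sum fun j _ => column_le_one hu hy hcol _ j
  have hsplit : ∀ g : Fin n → ℝ, ∑ i with utilities u x i ≤ t, g i =
      ∑ i ∈ poorAgents c u x t, g i +
        ∑ i with utilities u x i ≤ t ∧ ¬ utilities u x i < c, g i := fun g => by
    rw [← Finset.sum_filter_add_sum_filter_not _ (fun i => utilities u x i < c),
      Finset.filter_filter, Finset.filter_filter]
    rfl
  rw [hsplit, hsplit]
  refine add_le_add hpoor (Finset.sum_le_sum fun i hi => ?_)
  exact (hcap i).trans (not_lt.1 (Finset.mem_filter.1 hi).2.2)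

/-- Fairness depends on the utilities only. -/
theorem IsFair.of_utilities_eq (hu : Binary u) (hx : IsFair c u x) (hy : ∀ i j, 0 ≤ y i j)
    (hcol : ∀ j, ∑ i, y i j ≤ 1) (heq : utilities u y = utilities u x) : IsFair c u y := by
  refine ⟨hy, fun i j hij hi => ?_⟩
  rw [heq] at hi ⊢
  set A := poorAgents c u x (utilities u x i) with hA
  have hiA : i ∈ A := mem_poorAgents.2 ⟨le_rfl, hi⟩
  -- The poor agents have as much total utility in `y` as the number of items they like. Each of
  -- these items contributes at most one, so each is used up by them.
  have hsum : ∑ j ∈ likedSet u A, ∑ k ∈ A, y k j * u k j = ∑ j ∈ likedSet u A, (1 : ℝ) := by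
    rw [← hx.sum_poorAgents hu, ← hA, ← congrArg (fun g => ∑ i ∈ A, g i) heq]
    exact (sum_utilities_eq hu _ _ fun i hi j hij => mem_likedSet.2 ⟨i, hi, hij⟩).symm
  have hj : ∑ k ∈ A, y k j * u k j = 1 :=
    (Finset.sum_eq_sum_iff_of_le fun j _ => column_le_one hu hy hcol A j).1 hsum j
      (mem_likedSet.2 ⟨i, hiA, hij⟩)
  have h1 : ∑ k ∈ A, y k j * u k j ≤ ∑ k, y k j * u k j :=
    Finset.sum_le_univ_sum_of_nonneg fun k => hu.mul_nonneg hy k j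
  have h2 : ∑ k, y k j * u k j ≤ ∑ k, y k j := Finset.sum_le_sum fun k _ => hu.mul_le hy k j
  have h3 := hcol j
  refine ⟨by linarith, fun k hk => ?_⟩
  have hu1 : u k j = 1 := by
    have := (Finset.sum_eq_sum_iff_of_le fun k _ => hu.mul_le hy k j).1
      (by linarith : ∑ k, y k j * u k j = ∑ k, y k j) k (Finset.mem_univ k)
    exact (mul_eq_left₀ hk.ne').1 this
  refine ⟨hu1, ?_⟩
  by_contra hlt
  have hkA : k ∉ A := fun h => hlt (mem_poorAgents.1 h).1
  have h4 := Finset.sum_le_univ_sum_of_nonneg (s := insert k A)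
    fun k => hu.mul_nonneg hy k j
  rw [Finset.sum_insert hkA, hu1, mul_one] at h4
  linarith

/-- An item liked by an agent of utility zero would be fully held by agents liking it and having
utility zero, yet any positive holding yields positive utility. -/
theorem IsFair.utilities_pos (hu : Binary u) (hagent : ∀ i, ∃ j, u i j = 1) (hc : 0 < c)
    (hx : IsFair c u x) (i : Fin n) : 0 < utilities u x i := by
  by_contra h
  push Not at h
  obtain ⟨j, hj⟩ := hagent i
  obtain ⟨h1, h2⟩ := hx.2 i j hj (h.trans_lt hc)
  have : ∑ k, x k j = 0 := Finset.sum_eq_zero fun k _ => by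
    by_contra h0
    have hpos := (hx.1 k j).lt_of_ne' h0
    obtain ⟨h3, h4⟩ := h2 k hpos
    linarith [le_utilities hu hx.1 h3]
  linarith

/-! ### Fairness as leximin and Nash optimality -/

section Welfare

variable {S : Set (Mat n)}

/-- Admissible sets of assignments in which utilities do not exceed the cap. -/
def Capped (c : ℝ) (u : Mat n) (S : Set (Mat n)) : Prop :=
  ∀ y ∈ S, (∀ i j, 0 ≤ y i j) ∧ (∀ j, ∑ i, y i j ≤ 1) ∧ ∀ i, utilities u y i ≤ c

theorem IsFair.sublevelGE_of_mem (hu : Binary u) (hx : IsFair c u x) (hS : Capped c u S)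
    (hy : y ∈ S) : SublevelGE (utilities u x) (utilities u y) :=
  hx.sublevelGE hu (hS y hy).1 (hS y hy).2.1 (hS y hy).2.2

/-- Two different fair profiles would leximin dominate each other. -/
theorem IsFair.eq_of_isFair (hu : Binary u) (hx : IsFair c u x) (hy : IsFair c u y)
    (hS : Capped c u S) (hxS : x ∈ S) (hyS : y ∈ S) : utilities u y = utilities u x := by
  by_contra hne
  exact ((hx.sublevelGE_of_mem hu hS hyS).leximinDominates hne).asymm
    ((hy.sublevelGE_of_mem hu hS hxS).leximinDominates (Ne.symm hne))

theorem not_leximinDominates_self (v : Fin n → ℝ) : ¬ LeximinDominates v v :=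
  fun h => h.asymm h

theorem isLeximin_iff_isFair (hu : Binary u) (hx : IsFair c u x) (hS : Capped c u S)
    (hxS : x ∈ S) : IsLeximin S u y ↔ y ∈ S ∧ IsFair c u y := by
  refine and_congr_right fun hyS => ⟨fun h => ?_, fun h => ?_⟩
  · refine hx.of_utilities_eq hu (hS y hyS).1 (hS y hyS).2.1 ?_
    by_contra hne
    exact h ⟨x, hxS, (hx.sublevelGE_of_mem hu hS hyS).leximinDominates hne⟩
  · rintro ⟨z, hz, hdom⟩
    have hge := h.sublevelGE_of_mem hu hS hz
    by_cases heq : utilities u z = utilities u y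
    · exact not_leximinDominates_self _ (heq ▸ hdom)
    · exact hdom.asymm (hge.leximinDominates heq)

theorem isMNW_iff_isFair (hu : Binary u) (hagent : ∀ i, ∃ j, u i j = 1) (hc : 0 < c)
    (hx : IsFair c u x) (hS : Capped c u S) (hxS : x ∈ S) :
    IsMNW S u y ↔ y ∈ S ∧ IsFair c u y := by
  refine and_congr_right fun hyS => ⟨fun h => ?_, fun h z hz => ?_⟩
  · exact hx.of_utilities_eq hu (hS y hyS).1 (hS y hyS).2.1
      ((hx.sublevelGE_of_mem hu hS hyS).eq_of_prod_le (hx.utilities_pos hu hagent hc)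
        (utilities_nonneg hu (hS y hyS).1) (h x hxS))
  · exact (h.sublevelGE_of_mem hu hS hz).prod_le (h.utilities_pos hu hagent hc)
      (utilities_nonneg hu (hS z hz).1)

theorem capped_balancedAssignments (hu : Binary u) : Capped 1 u (balancedAssignments n) :=
  fun _ hy => ⟨fun i j => (hy.1.1 i j).1, fun j => (hy.1.2 j).le,
    fun i => (utilities_le_sum hu (fun i j => (hy.1.1 i j).1) i).trans_eq (hy.2 i)⟩

theorem utilities_le_card (hu : Binary u) (hy : y ∈ assignments n) (i : Fin n) :
    utilities u y i ≤ n := by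
  refine (utilities_le_sum hu (fun i j => (hy.1 i j).1) i).trans ?_
  refine (Finset.sum_le_sum fun j _ => (hy.1 i j).2).trans ?_
  simp

theorem capped_assignments (hu : Binary u) : Capped (n + 1) u (assignments n) :=
  fun _ hy => ⟨fun i j => (hy.1 i j).1, fun j => (hy.2 j).le,
    fun i => (utilities_le_card hu hy i).trans (by linarith)⟩

end Welfare

end Fairness

/-! ### Market equilibria: HZ and CEEI -/

section Markets

variable {n : ℕ} {u x : Mat n} {c : ℝ}

theorem cost_single (p : Fin n → ℝ) (j : Fin n) (t : ℝ) : cost p (Pi.single j t) = p j * t :=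
  dotProduct_single p t j

theorem cost_add (p b b' : Fin n → ℝ) : cost p (b + b') = cost p b + cost p b' :=
  dotProduct_add p b b'

theorem bundleUtility_single (a : Fin n → ℝ) (j : Fin n) (t : ℝ) :
    bundleUtility a (Pi.single j t) = t * a j :=
  single_dotProduct a t j

theorem bundleUtility_add (a b b' : Fin n → ℝ) :
    bundleUtility a (b + b') = bundleUtility a b + bundleUtility a b' :=
  add_dotProduct b b' a

theorem cost_nonneg {p b : Fin n → ℝ} (hp : ∀ j, 0 ≤ p j) (hb : ∀ j, 0 ≤ b j) : 0 ≤ cost p b :=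
  Finset.sum_nonneg fun j _ => mul_nonneg (hp j) (hb j)

/-- The items in a cheapest optimal bundle of a Hylland-Zeckhauser agent are the cheapest ones
among those that are at least as good. -/
theorem IsCheapestDemand.price_le {a p b : Fin n → ℝ}
    (h : IsCheapestDemand (balancedBundles n) a p b) {j k : Fin n} (hj : 0 < b j)
    (hjk : a j ≤ a k) : p j ≤ p k := by
  rcases eq_or_ne j k with rfl | hne
  · exact le_rfl
  have hb := h.1.1
  -- Replace the whole amount of `j` by the same amount of `k`.
  set b' : Fin n → ℝ := b + (Pi.single k (b j) + Pi.single j (-b j)) with hb'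
  have hmem : b' ∈ balancedBundles n := by
    refine ⟨fun l => ?_, ?_⟩
    · have h1 : 0 ≤ Pi.single (M := fun _ => ℝ) k (b j) l := by
        rw [Pi.single_apply]; split_ifs <;> simp [hj.le]
      rcases eq_or_ne l j with rfl | hl
      · simp only [hb', Pi.add_apply, Pi.single_eq_same]; linarith
      · simp only [hb', Pi.add_apply, Pi.single_eq_of_ne hl]
        linarith [hb.1 l]
    · simp only [hb', Pi.add_apply, Finset.sum_add_distrib, hb.2, Finset.sum_pi_single',
        Finset.mem_univ, if_true]
      ring
  have hutil : bundleUtility a b ≤ bundleUtility a b' := by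
    rw [hb', bundleUtility_add, bundleUtility_add, bundleUtility_single, bundleUtility_single]
    nlinarith
  have hcost := h.2.2 ⟨b', hmem, hutil, rfl⟩
  rw [hb', cost_add, cost_add, cost_single, cost_single] at hcost
  by_contra hlt
  push Not at hlt
  nlinarith

theorem single_mem_balancedBundles (j : Fin n) : Pi.single j 1 ∈ balancedBundles n := by
  refine ⟨fun l => ?_, by simp [Finset.sum_pi_single']⟩
  rw [Pi.single_apply]; split_ifs <;> simp

/-- If `k` holds an item `j` liked by an unsatisfied agent `i`, then `i` could afford the utility of
`k`: all items that `k` likes and buys cost at least `p j`, so `j` can stand in for them, and a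
cheapest item for the rest. -/
theorem IsHZ.isFair (hu : Binary u) (h : IsHZ u x) : IsFair 1 u x := by
  obtain ⟨hx, p, hp, hd⟩ := h
  have hx0 : ∀ i j, 0 ≤ x i j := fun i j => (hx.1.1 i j).1
  refine ⟨hx0, fun i j hij hi => ⟨hx.1.2 j, ?_⟩⟩
  -- Otherwise `i` would buy a full unit of `j`.
  have hpj : 1 < p j := by
    by_contra hle
    push Not at hle
    have := (hd i).1.2.2 _ (single_mem_balancedBundles j) (by rw [cost_single]; linarith)
    rw [bundleUtility_single, hij] at this
    have hi' : bundleUtility (u i) (x i) < 1 := hi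
    linarith
  -- A cheapest item costs at most 1, since every agent affords a full unit of something.
  obtain ⟨q, -, hq⟩ := Finset.univ.exists_min_image p ⟨j, Finset.mem_univ j⟩
  have hq1 : p q ≤ 1 := by
    refine le_trans ?_ (hd i).1.2.1
    calc p q = ∑ l, p q * x i l := by rw [← Finset.mul_sum, hx.2 i, mul_one]
      _ ≤ cost p (x i) := Finset.sum_le_sum fun l _ =>
          mul_le_mul_of_nonneg_right (hq l (Finset.mem_univ l)) (hx0 i l)
  intro k hk
  have hkj : u k j = 1 := by
    refine (hu k j).resolve_left fun h0 => ?_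
    have := (hd k).price_le hk (h0.trans_le (hu.nonneg k q))
    linarith
  refine ⟨hkj, ?_⟩
  set t := utilities u x k with ht
  have ht0 : 0 ≤ t := utilities_nonneg hu hx0 k
  have ht1 : t ≤ 1 := (utilities_le_sum hu hx0 k).trans_eq (hx.2 k)
  set b : Fin n → ℝ := Pi.single j t + Pi.single q (1 - t) with hb
  have hbmem : b ∈ balancedBundles n := by
    refine ⟨fun l => add_nonneg ?_ ?_, ?_⟩
    · rw [Pi.single_apply]; split_ifs <;> simp [ht0]
    · rw [Pi.single_apply]; split_ifs <;> simp [ht1]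
    · simp [hb, Finset.sum_add_distrib, Finset.sum_pi_single']
  have hcost : cost p b ≤ 1 := by
    refine le_trans ?_ (hd k).1.2.1
    rw [hb, cost_add, cost_single, cost_single]
    calc p j * t + p q * (1 - t)
        = ∑ l, (p j * (x k l * u k l) + p q * (x k l - x k l * u k l)) := by
          rw [Finset.sum_add_distrib, ← Finset.mul_sum, ← Finset.mul_sum,
            Finset.sum_sub_distrib, hx.2 k]
          rfl
      _ ≤ cost p (x k) := Finset.sum_le_sum fun l _ => ?_
    rcases hu k l with h0 | h0
    · rw [h0]
      have := mul_le_mul_of_nonneg_right (hq l (Finset.mem_univ l)) (hx0 k l)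
      linarith
    · rw [h0]
      have := mul_le_mul_of_nonneg_right ((hd k).price_le hk (hkj.trans h0.symm).le) (hx0 k l)
      linarith
  have hle : bundleUtility (u i) b ≤ utilities u x i := (hd i).1.2.2 b hbmem hcost
  rw [hb, bundleUtility_add, bundleUtility_single, bundleUtility_single, hij] at hle
  have := mul_nonneg (sub_nonneg.2 ht1) (hu.nonneg i q)
  linarith

/-- Every item has positive price, so cheapest bundles contain only liked items, all of the holder's
least price. Spending the holder's budget on `j` alone thus gives any other fan of `j` at least the
holder's utility. No cap is involved. -/
theorem IsCEEI.isFair (hu : Binary u) (hitem : ∀ j, ∃ i, u i j = 1) (h : IsCEEI u x) (c : ℝ) :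
    IsFair c u x := by
  obtain ⟨hx, p, hp, hd⟩ := h
  have hx0 : ∀ i j, 0 ≤ x i j := fun i j => (hx.1 i j).1
  have hsingle : ∀ (j : Fin n) (t : ℝ), 0 ≤ t → Pi.single j t ∈ bundles n := fun j t ht l => by
    rw [Pi.single_apply]; split_ifs <;> simp [ht]
  have hpos : ∀ j, 0 < p j := fun j => by
    refine (hp j).lt_of_ne fun h0 => ?_
    obtain ⟨i, hij⟩ := hitem j
    have hi0 := utilities_nonneg hu hx0 i
    have := (hd i).1.2.2 _ (hsingle j (utilities u x i + 1) (by linarith))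
      (by rw [cost_single, ← h0]; simp)
    rw [bundleUtility_single, hij] at this
    have h1 : utilities u x i = bundleUtility (u i) (x i) := rfl
    linarith
  refine ⟨hx0, fun i j hij hi => ⟨hx.2 j, fun k hk => ?_⟩⟩
  -- Trading all of `j` for an amount `s` of `l` without losing utility cannot save money.
  have hswap : ∀ (l : Fin n) (s : ℝ), 0 ≤ s → x k j * u k j ≤ s * u k l →
      p j * x k j ≤ p l * s := by
    intro l s hs hts
    set b : Fin n → ℝ := x k + Pi.single j (-x k j) + Pi.single l s with hb
    have hmem : b ∈ bundles n := fun m => by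
      refine add_nonneg ?_ (hsingle l s hs m)
      rcases eq_or_ne m j with rfl | hm
      · simp
      · simp only [Pi.add_apply, Pi.single_eq_of_ne hm, add_zero]; exact hx0 k m
    have hcost := (hd k).2.2 ⟨b, hmem, by
      rw [hb, bundleUtility_add, bundleUtility_add, bundleUtility_single, bundleUtility_single]
      linarith, rfl⟩
    rw [hb, cost_add, cost_add, cost_single, cost_single] at hcost
    linarith
  have hkj : u k j = 1 := by
    refine (hu k j).resolve_left fun h0 => ?_
    have := hswap j 0 le_rfl (by simp [h0])
    nlinarith [hpos j]
  refine ⟨hkj, ?_⟩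
  set t := utilities u x k with ht
  have ht0 : 0 ≤ t := utilities_nonneg hu hx0 k
  have hprice : ∀ l, p j * (x k l * u k l) ≤ p l * x k l := fun l => by
    rcases hu k l with h0 | h0
    · rw [h0, mul_zero, mul_zero]; exact mul_nonneg (hp l) (hx0 k l)
    · rw [h0, mul_one]
      refine mul_le_mul_of_nonneg_right ?_ (hx0 k l)
      exact le_of_mul_le_mul_right (hswap l (x k j) hk.le (by rw [h0, hkj])) hk
  have hcost : cost p (Pi.single j t) ≤ 1 := by
    refine le_trans ?_ (hd k).1.2.1
    rw [cost_single, ht, utilities_apply, Finset.mul_sum]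
    exact Finset.sum_le_sum fun l _ => hprice l
  have hle : bundleUtility (u i) (Pi.single j t) ≤ utilities u x i :=
    (hd i).1.2.2 _ (hsingle j t ht0) hcost
  rwa [bundleUtility_single, hij, mul_one] at hle

/-- Supporting prices: an item costs `1 / f i`, for the agent `i` of least utility `f i < c` who
likes it, and it is free if there is no such agent. -/
theorem exists_prices (u : Mat n) (c : ℝ) {f : Fin n → ℝ} (hf : ∀ i, 0 < f i) :
    ∃ p : Fin n → ℝ, (∀ j, 0 ≤ p j) ∧ (∀ i j, u i j = 1 → f i < c → (f i)⁻¹ ≤ p j) ∧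
      ∀ j, p j = 0 ∨ ∃ i, u i j = 1 ∧ f i < c ∧ p j = (f i)⁻¹ := by
  have key : ∀ j, ∃ q : ℝ, 0 ≤ q ∧ (∀ i, u i j = 1 → f i < c → (f i)⁻¹ ≤ q) ∧
      (q = 0 ∨ ∃ i, u i j = 1 ∧ f i < c ∧ q = (f i)⁻¹) := fun j => by
    by_cases hne : ∃ i, u i j = 1 ∧ f i < c
    · obtain ⟨i₀, hi₀⟩ := hne
      obtain ⟨i, hi, hmin⟩ := (Finset.univ.filter fun i => u i j = 1 ∧ f i < c).exists_min_image f
        ⟨i₀, by simpa using hi₀⟩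
      simp only [Finset.mem_filter, Finset.mem_univ, true_and] at hi hmin
      exact ⟨(f i)⁻¹, (inv_pos.2 (hf i)).le, fun k h1 h2 => inv_anti₀ (hf i) (hmin k ⟨h1, h2⟩),
        Or.inr ⟨i, hi.1, hi.2, rfl⟩⟩
    · push Not at hne
      exact ⟨0, le_rfl, fun i h1 h2 => absurd h2 (not_lt.2 (hne i h1)), Or.inl rfl⟩
  choose p h1 h2 h3 using key
  exact ⟨p, h1, fun i j => h2 j i, h3⟩

/-- For an agent of utility `t` below the cap, liked items cost at least `1 / t` per unit, so
utility is at most `t` times cost. Her own items cost exactly `1 / t`: by fairness she is no richer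
than the poorest fan of each. So her bundle costs exactly 1 and attains the bound. -/
theorem IsFair.isCheapestDemand (hu : Binary u) (hx : IsFair c u x)
    (hpos : ∀ i, 0 < utilities u x i) {p : Fin n → ℝ} (hp0 : ∀ j, 0 ≤ p j)
    (hp1 : ∀ i j, u i j = 1 → utilities u x i < c → (utilities u x i)⁻¹ ≤ p j)
    (hp2 : ∀ j, p j = 0 ∨ ∃ i, u i j = 1 ∧ utilities u x i < c ∧ p j = (utilities u x i)⁻¹)
    {B : Set (Fin n → ℝ)} (hB : ∀ b ∈ B, ∀ j, 0 ≤ b j) {i : Fin n} (hi : utilities u x i < c)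
    (hmem : x i ∈ B) : IsCheapestDemand B (u i) p (x i) := by
  set t := utilities u x i with ht
  have hcost : cost p (x i) = 1 := by
    rw [← inv_mul_cancel₀ (hpos i).ne']
    nth_rw 2 [utilities_apply]
    rw [Finset.mul_sum]
    refine Finset.sum_congr rfl fun j _ => ?_
    rcases (hx.1 i j).eq_or_lt with h0 | h0
    · simp [← h0]
    rcases hp2 j with hj | ⟨k, hkj, hk, hj⟩
    · have : u i j = 0 := (hu i j).resolve_right fun h1 => by
        have := hp1 i j h1 hi
        rw [hj] at this
        exact absurd this (not_le.2 (inv_pos.2 (hpos i)))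
      simp [hj, this]
    · obtain ⟨h1, h2⟩ := (hx.2 k j hkj hk).2 i h0
      rw [le_antisymm (hj.trans_le (inv_anti₀ (hpos i) h2)) (hp1 i j h1 hi), h1, mul_one]
  have hbound : ∀ b ∈ B, bundleUtility (u i) b ≤ t * cost p b := fun b hb => by
    unfold bundleUtility cost
    rw [Finset.mul_sum]
    refine Finset.sum_le_sum fun j _ => ?_
    rcases hu i j with h0 | h0
    · rw [h0, mul_zero]; exact mul_nonneg (hpos i).le (mul_nonneg (hp0 j) (hB b hb j))
    · have h1 := mul_le_mul_of_nonneg_left (hp1 i j h0 hi) (hpos i).le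
      rw [mul_inv_cancel₀ (hpos i).ne'] at h1
      have := mul_le_mul_of_nonneg_right h1 (hB b hb j)
      rw [h0]; linarith
  refine ⟨⟨hmem, hcost.le, fun b hb hb1 => (hbound b hb).trans ?_⟩, ⟨x i, hmem, le_rfl, rfl⟩, ?_⟩
  · exact mul_le_of_le_one_right (hpos i).le hb1
  · rintro _ ⟨b, hb, hle, rfl⟩
    rw [hcost]
    have h1 : t * 1 ≤ t * cost p b := by rw [mul_one]; exact hle.trans (hbound b hb)
    exact le_of_mul_le_mul_left h1 (hpos i)

theorem IsFair.isCEEI (hu : Binary u) (hagent : ∀ i, ∃ j, u i j = 1)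
    (hx : IsFair (n + 1) u x) (hmem : x ∈ assignments n) : IsCEEI u x := by
  have hpos := hx.utilities_pos hu hagent (by positivity)
  obtain ⟨p, h1, h2, h3⟩ := exists_prices u (n + 1) hpos
  exact ⟨hmem, p, h1, fun i => hx.isCheapestDemand hu hpos h1 h2 h3 (fun b hb => hb)
    ((utilities_le_card hu hmem i).trans_lt (by linarith)) (hx.1 i)⟩

theorem IsFair.isHZ (hu : Binary u) (hagent : ∀ i, ∃ j, u i j = 1)
    (hx : IsFair 1 u x) (hmem : x ∈ balancedAssignments n) : IsHZ u x := by
  have hpos := hx.utilities_pos hu hagent one_pos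
  obtain ⟨p, h1, h2, h3⟩ := exists_prices u 1 hpos
  refine ⟨hmem, p, h1, fun i => ?_⟩
  have hi : x i ∈ balancedBundles n := ⟨hx.1 i, hmem.2 i⟩
  by_cases hlt : utilities u x i < 1
  · exact hx.isCheapestDemand hu hpos h1 h2 h3 (fun b hb => hb.1) hlt hi
  -- A satisfied agent holds only free items: a priced one has a fan below the cap, and fairness
  -- would put its holder below the cap too.
  have hcost : cost p (x i) = 0 := Finset.sum_eq_zero fun j _ => by
    rcases (hx.1 i j).eq_or_lt with h0 | h0
    · simp [← h0]
    rcases h3 j with hj | ⟨k, hkj, hk, -⟩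
    · simp [hj]
    · exact absurd (((hx.2 k j hkj hk).2 i h0).2.trans_lt hk) hlt
  refine ⟨⟨hi, hcost.trans_le zero_le_one, fun b hb _ => ?_⟩, ⟨x i, hi, le_rfl, rfl⟩, ?_⟩
  · refine le_trans ?_ (not_lt.1 hlt)
    rw [← hb.2]
    exact Finset.sum_le_sum fun j _ => mul_le_of_le_one_right (hb.1 j) (hu.le_one i j)
  · rintro _ ⟨b, hb, -, rfl⟩
    rw [hcost]
    exact cost_nonneg h1 hb.1

end Markets

/-! ### Extended probabilistic serial -/

section Serial

variable {n : ℕ} {u x y z : Mat n} {c : ℝ} {A P X : Finset (Fin n)}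

theorem mem_likedBy {C : Finset (Fin n)} {j : Fin n} :
    j ∈ likedBy u C P ↔ ∃ i ∈ C, j ∈ favourites u i ∧ j ∈ P := by
  simp [likedBy]

/-- A fractional form of Hall's theorem. -/
theorem exists_givesAmount (u : Mat n) (X P : Finset (Fin n)) (a b : ℕ) (hb : 0 < b)
    (h : ∀ C ⊆ X, a * C.card ≤ b * (likedBy u C P).card) :
    ∃ z, GivesAmount u X P ((a : ℝ) / b) z := by
  classical
  -- Hall's theorem for `a` clones of each agent and `b` clones of each item; each matched pair of
  -- clones carries an amount `1 / b`.
  obtain ⟨f, hinj, hf⟩ := (Finset.all_card_le_biUnion_card_iff_exists_injective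
    (fun s : X × Fin a => (favourites u s.1 ∩ P) ×ˢ (Finset.univ : Finset (Fin b)))).1 (by
      intro S
      set C : Finset (Fin n) := S.image fun s => (s.1 : Fin n) with hC
      have hCX : C ⊆ X := fun i hi => by
        obtain ⟨s, -, rfl⟩ := Finset.mem_image.1 hi
        exact s.1.2
      have h1 : S.card ≤ (C ×ˢ (Finset.univ : Finset (Fin a))).card := by
        refine Finset.card_le_card_of_injOn (fun s => ((s.1 : Fin n), s.2)) (fun s hs => ?_) ?_
        · simp only [Finset.coe_product, Set.mem_prod, Finset.mem_coe, Finset.mem_univ, and_true]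
          exact Finset.mem_image_of_mem _ hs
        · rintro ⟨s, s'⟩ - ⟨t, t'⟩ - hst
          obtain ⟨h1, h2⟩ := Prod.ext_iff.1 hst
          exact Prod.ext (Subtype.ext h1) h2
      have h2 : ((likedBy u C P) ×ˢ (Finset.univ : Finset (Fin b))) ⊆ S.biUnion
          fun s : X × Fin a => (favourites u s.1 ∩ P) ×ˢ (Finset.univ : Finset (Fin b)) := by
        rintro ⟨j, r⟩ hjr
        rw [Finset.mem_product, mem_likedBy] at hjr
        obtain ⟨⟨i, hi, hj⟩, -⟩ := hjr
        obtain ⟨s, hs, rfl⟩ := Finset.mem_image.1 hi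
        exact Finset.mem_biUnion.2 ⟨s, hs, by simp [hj.1, hj.2]⟩
      have h3 := Finset.card_le_card h2
      have h4 := h C hCX
      rw [Finset.card_product, Finset.card_fin] at h1 h3
      refine h1.trans (le_trans ?_ h3)
      rw [mul_comm, mul_comm _ b]
      exact h4)
  have hb' : (0 : ℝ) < b := by exact_mod_cast hb
  refine ⟨fun i j => ((Finset.univ.filter fun s : X × Fin a =>
    (s.1 : Fin n) = i ∧ (f s).1 = j).card : ℝ) / b, fun i j => by positivity, ?_, ?_, ?_⟩
  · intro i j hij
    have : (Finset.univ.filter fun s : X × Fin a => (s.1 : Fin n) = i ∧ (f s).1 = j).Nonempty := by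
      by_contra h0
      rw [Finset.not_nonempty_iff_eq_empty] at h0
      exact hij (by simp [h0])
    obtain ⟨s, hs⟩ := this
    obtain ⟨rfl, rfl⟩ := (Finset.mem_filter.1 hs).2
    exact ⟨s.1.2, (Finset.mem_product.1 (hf s)).1⟩
  · intro i hi
    rw [← Finset.sum_div, ← Nat.cast_sum]
    congr 2
    have h1 := Finset.card_eq_sum_card_fiberwise (f := fun s : X × Fin a => (f s).1)
      (s := Finset.univ.filter fun s : X × Fin a => (s.1 : Fin n) = i) (t := Finset.univ)
      (fun _ _ => Finset.mem_coe.2 (Finset.mem_univ _))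
    simp only [Finset.filter_filter] at h1
    rw [← h1]
    have h2 : (Finset.univ.filter fun s : X × Fin a => (s.1 : Fin n) = i) =
        {(⟨i, hi⟩ : X)} ×ˢ Finset.univ := by
      ext s
      rw [Finset.mem_filter, Finset.mem_product, Finset.mem_singleton, Subtype.ext_iff]
      simp
    rw [h2]
    simp
  · intro j
    rw [← Finset.sum_div, div_le_one hb', ← Nat.cast_sum, Nat.cast_le]
    have h1 := Finset.card_eq_sum_card_fiberwise (f := fun s : X × Fin a => (s.1 : Fin n))
      (s := Finset.univ.filter fun s : X × Fin a => (f s).1 = j) (t := Finset.univ)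
      (fun _ _ => Finset.mem_coe.2 (Finset.mem_univ _))
    simp only [Finset.filter_filter] at h1
    have h2 : (Finset.univ.filter fun s : X × Fin a => (f s).1 = j).card ≤
        (Finset.univ : Finset (Fin b)).card := by
      refine Finset.card_le_card_of_injOn (fun s => (f s).2) (fun _ _ => by simp) ?_
      intro s hs t ht hst
      have hs' : (f s).1 = j := by simpa using hs
      have ht' : (f t).1 = j := by simpa using ht
      exact hinj (Prod.ext (hs'.trans ht'.symm) hst)
    rw [Finset.card_fin, h1] at h2
    refine le_trans (le_of_eq ?_) h2
    refine Finset.sum_congr rfl fun i _ => ?_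
    congr 1
    ext s
    simp [and_comm]

theorem card_pos_real (hX : X.Nonempty) : (0 : ℝ) < X.card := by
  exact_mod_cast hX.card_pos

theorem ratio_mul_card (hX : X.Nonempty) : ratio u P X * X.card = (likedBy u X P).card :=
  div_mul_cancel₀ _ (card_pos_real hX).ne'

theorem ratio_le_card (hX : X.Nonempty) : ratio u P X ≤ n := by
  refine (div_le_iff₀ (card_pos_real hX)).2 ?_
  have h1 : ((likedBy u X P).card : ℝ) ≤ n := by
    exact_mod_cast (Finset.card_le_univ _).trans_eq (Fintype.card_fin n)
  have h2 : (1 : ℝ) ≤ X.card := by exact_mod_cast hX.card_pos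
  nlinarith [Nat.cast_nonneg (α := ℝ) n]

theorem exists_isBottleneck (u : Mat n) (P : Finset (Fin n)) (hA : A.Nonempty) :
    ∃ X, IsBottleneck u A P X := by
  classical
  obtain ⟨M, hM, hmin⟩ := (A.powerset.filter Finset.Nonempty).exists_min_image (ratio u P)
    ⟨A, by simp [hA]⟩
  simp only [Finset.mem_filter, Finset.mem_powerset] at hM hmin
  obtain ⟨X, hX, hmax⟩ := (Finset.univ.filter fun X => MinimisesRatio u A P X).exists_max_image
    Finset.card ⟨M, by
      simp only [Finset.mem_filter, Finset.mem_univ, true_and]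
      exact ⟨hM.1, hM.2, fun C h1 h2 => hmin C ⟨h1, h2⟩⟩⟩
  simp only [Finset.mem_filter, Finset.mem_univ, true_and] at hX hmax
  exact ⟨X, hX, hmax⟩

theorem GivesAmount.restrict {v : ℝ} (hz : GivesAmount u X P v z) :
    GivesAmount u X (likedBy u X P) v z := by
  refine ⟨hz.1, fun i j hij => ?_, hz.2.2⟩
  obtain ⟨h1, h2⟩ := hz.2.1 i j hij
  rw [Finset.mem_inter] at h2
  exact ⟨h1, Finset.mem_inter.2 ⟨h2.1, mem_likedBy.2 ⟨i, h1, h2⟩⟩⟩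

theorem MinimisesRatio.exists_givesAmount (hX : MinimisesRatio u A P X) :
    ∃ z, GivesAmount u X (likedBy u X P) (ratio u P X) z := by
  obtain ⟨z, hz⟩ := RandomAssignment.exists_givesAmount u X P (likedBy u X P).card X.card
    hX.2.1.card_pos (fun C hC => by
      rcases C.eq_empty_or_nonempty with rfl | hne
      · simp
      have := hX.2.2 C (hC.trans hX.1) hne
      rw [ratio, ratio, div_le_div_iff₀ (card_pos_real hX.2.1) (card_pos_real hne)] at this
      rw [mul_comm X.card]
      exact_mod_cast this)
  exact ⟨z, hz.restrict⟩

/-- A minimal ratio of at least 1 is Hall's condition for giving everybody one unit. -/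
theorem MinimisesRatio.ratio_lt_one (hX : MinimisesRatio u A P X)
    (h : ¬ ∃ z, GivesAmount u A P 1 z) : ratio u P X < 1 := by
  by_contra hle
  push Not at hle
  refine h ?_
  have := RandomAssignment.exists_givesAmount u A P 1 1 one_pos (fun C hC => by
    rcases C.eq_empty_or_nonempty with rfl | hne
    · simp
    have := hle.trans (hX.2.2 C hC hne)
    rw [ratio, le_div_iff₀ (card_pos_real hne), one_mul] at this
    rw [one_mul, one_mul]
    exact_mod_cast this)
  simpa using this

/-- The ratios do not decrease when a minimiser leaves with the items it likes. -/
theorem MinimisesRatio.le_ratio_sdiff (hX : MinimisesRatio u A P X) {C : Finset (Fin n)}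
    (hC : C ⊆ A \ X) (hne : C.Nonempty) :
    ratio u P X ≤ ratio u (P \ likedBy u X P) C := by
  -- Compare with `X ∪ C`: its ratio is at most the mediant of the ratio of `X` and the residual
  -- ratio of `C`.
  have hunion := hX.2.2 (X ∪ C)
    (Finset.union_subset hX.1 (hC.trans Finset.sdiff_subset)) (hX.2.1.mono Finset.subset_union_left)
  have hdisj : Disjoint X C := Finset.disjoint_of_subset_right hC Finset.disjoint_sdiff
  have hsub : likedBy u (X ∪ C) P ⊆ likedBy u X P ∪ likedBy u C (P \ likedBy u X P) := by
    intro j hj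
    by_cases hjX : j ∈ likedBy u X P
    · exact Finset.mem_union_left _ hjX
    obtain ⟨i, hi, hj'⟩ := mem_likedBy.1 hj
    rcases Finset.mem_union.1 hi with hi | hi
    · exact absurd (mem_likedBy.2 ⟨i, hi, hj'⟩) hjX
    · exact Finset.mem_union_right _
        (mem_likedBy.2 ⟨i, hi, hj'.1, Finset.mem_sdiff.2 ⟨hj'.2, hjX⟩⟩)
  have hcard : ((likedBy u (X ∪ C) P).card : ℝ) ≤
      (likedBy u X P).card + (likedBy u C (P \ likedBy u X P)).card := by
    exact_mod_cast (Finset.card_le_card hsub).trans (Finset.card_union_le _ _)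
  have hpos := card_pos_real (hX.2.1.mono (Finset.subset_union_left (s₂ := C)))
  nth_rw 2 [ratio] at hunion
  rw [le_div_iff₀ hpos, Finset.card_union_of_disjoint hdisj, Nat.cast_add, mul_add,
    ratio_mul_card hX.2.1] at hunion
  rw [ratio.eq_1 u (P \ likedBy u X P) C, le_div_iff₀ (card_pos_real hne)]
  linarith

/-- The properties of a partial assignment of the items `P` to the agents `A` that serial rules
maintain: fairness below the cap `c`, and lower bounds on the amounts. -/
structure IsPartialFair (c : ℝ) (u : Mat n) (A P : Finset (Fin n)) (x : Mat n) : Prop where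
  nonneg : ∀ i j, 0 ≤ x i j
  support : ∀ i j, x i j ≠ 0 → i ∈ A ∧ j ∈ favourites u i ∩ P
  column_le : ∀ j, ∑ i, x i j ≤ 1
  row_le : ∀ i ∈ A, ∑ j, x i j ≤ c
  fair : ∀ i ∈ A, ∑ j, x i j < c → ∀ j ∈ favourites u i ∩ P,
    ∑ k, x k j = 1 ∧ ∀ k, x k j ≠ 0 → ∑ l, x k l ≤ ∑ l, x i l
  le_row : ∀ w ≤ c, (∀ C ⊆ A, C.Nonempty → w ≤ ratio u P C) → ∀ i ∈ A, w ≤ ∑ j, x i j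

theorem isPartialFair_empty (c : ℝ) (u : Mat n) (P : Finset (Fin n)) :
    IsPartialFair c u ∅ P 0 := by
  constructor <;> simp

/-- With the cap equal to the common amount, nobody is below the cap and fairness is vacuous. -/
theorem GivesAmount.isPartialFair {v : ℝ} (hz : GivesAmount u A P v z) :
    IsPartialFair v u A P z where
  nonneg := hz.1
  support := hz.2.1
  column_le := hz.2.2.2
  row_le i hi := (hz.2.2.1 i hi).le
  fair i hi hlt := absurd (hz.2.2.1 i hi) hlt.ne
  le_row _ hw _ i hi := hw.trans_eq (hz.2.2.1 i hi).symm

/-- The total handed out, ratio times `X.card`, equals the number of items in `likedBy u X P`, so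
none has anything left. -/
theorem GivesAmount.column_eq_one (hX : X.Nonempty)
    (hz : GivesAmount u X (likedBy u X P) (ratio u P X) z) {j : Fin n}
    (hj : j ∈ likedBy u X P) : ∑ i, z i j = 1 := by
  refine (Finset.sum_eq_sum_iff_of_le fun j _ => hz.2.2.2 j).1 ?_ j hj
  have h1 : ∑ j ∈ likedBy u X P, ∑ i, z i j = ∑ j, ∑ i, z i j :=
    Finset.sum_subset (Finset.subset_univ _) fun j _ hj => Finset.sum_eq_zero fun i _ => by
      by_contra h0
      exact hj (Finset.mem_inter.1 (hz.2.1 i j h0).2).2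
  have h2 : ∑ i ∈ X, ∑ j, z i j = ∑ i, ∑ j, z i j :=
    Finset.sum_subset (Finset.subset_univ _) fun i _ hi => Finset.sum_eq_zero fun j _ => by
      by_contra h0
      exact hi (hz.2.1 i j h0).1
  rw [h1, Finset.sum_comm, ← h2, Finset.sum_congr rfl hz.2.2.1]
  simp only [Finset.sum_const, nsmul_eq_mul, mul_one]
  rw [mul_comm, ratio_mul_card hX]

/-- Agents served later get at least the amount of the current bottleneck set, by `le_row` and the
monotonicity of the ratios. Hence they do not envy those leaving now, who in turn like no item that
remains. -/
theorem IsPartialFair.add (hX : MinimisesRatio u A P X) (hc : ratio u P X ≤ c)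
    (hz : GivesAmount u X (likedBy u X P) (ratio u P X) z)
    (hx : IsPartialFair c u (A \ X) (P \ likedBy u X P) x) :
    IsPartialFair c u A P (z + x) := by
  set L := likedBy u X P with hL
  have hx_row : ∀ i ∈ X, ∀ j, x i j = 0 := fun i hi j => by
    by_contra h0
    exact (Finset.mem_sdiff.1 (hx.support i j h0).1).2 hi
  have hz_row : ∀ i ∉ X, ∀ j, z i j = 0 := fun i hi j => by
    by_contra h0
    exact hi (hz.2.1 i j h0).1
  have hx_col : ∀ j ∈ L, ∀ i, x i j = 0 := fun j hj i => by
    by_contra h0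
    exact (Finset.mem_sdiff.1 (Finset.mem_inter.1 (hx.support i j h0).2).2).2 hj
  have hz_col : ∀ j ∉ L, ∀ i, z i j = 0 := fun j hj i => by
    by_contra h0
    exact hj (Finset.mem_inter.1 (hz.2.1 i j h0).2).2
  have row_mem : ∀ i ∈ X, ∑ j, (z + x) i j = ratio u P X := fun i hi => by
    rw [← hz.2.2.1 i hi]
    exact Finset.sum_congr rfl fun j _ => by simp [hx_row i hi j]
  have row_notMem : ∀ i ∉ X, ∑ j, (z + x) i j = ∑ j, x i j := fun i hi =>
    Finset.sum_congr rfl fun j _ => by simp [hz_row i hi j]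
  have col_mem : ∀ j ∈ L, ∑ i, (z + x) i j = 1 := fun j hj => by
    rw [← hz.column_eq_one hX.2.1 hj]
    exact Finset.sum_congr rfl fun i _ => by simp [hx_col j hj i]
  have col_notMem : ∀ j ∉ L, ∑ i, (z + x) i j = ∑ i, x i j := fun j hj =>
    Finset.sum_congr rfl fun i _ => by simp [hz_col j hj i]
  have hlow : ∀ i ∈ A, ratio u P X ≤ ∑ j, (z + x) i j := fun i hi => by
    by_cases hiX : i ∈ X
    · exact (row_mem i hiX).ge
    · rw [row_notMem i hiX]
      exact hx.le_row _ hc (fun C hC hne => hX.le_ratio_sdiff hC hne) i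
        (Finset.mem_sdiff.2 ⟨hi, hiX⟩)
  refine ⟨fun i j => add_nonneg (hz.1 i j) (hx.nonneg i j), fun i j hij => ?_, fun j => ?_,
    fun i hi => ?_, fun i hi hlt j hj => ?_, fun w hw h i hi => ?_⟩
  · by_cases hiX : i ∈ X
    · have hij' : z i j ≠ 0 := by simpa [hx_row i hiX j] using hij
      obtain ⟨h1, h2⟩ := Finset.mem_inter.1 (hz.2.1 i j hij').2
      obtain ⟨-, -, -, h3⟩ := mem_likedBy.1 h2
      exact ⟨hX.1 hiX, Finset.mem_inter.2 ⟨h1, h3⟩⟩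
    · have hij' : x i j ≠ 0 := by simpa [hz_row i hiX j] using hij
      obtain ⟨h0, h1⟩ := hx.support i j hij'
      rw [Finset.mem_inter] at h1
      exact ⟨(Finset.mem_sdiff.1 h0).1,
        Finset.mem_inter.2 ⟨h1.1, (Finset.mem_sdiff.1 h1.2).1⟩⟩
  · by_cases hj : j ∈ L
    · exact (col_mem j hj).le
    · exact (col_notMem j hj).trans_le (hx.column_le j)
  · by_cases hiX : i ∈ X
    · exact (row_mem i hiX).trans_le hc
    · exact (row_notMem i hiX).trans_le (hx.row_le i (Finset.mem_sdiff.2 ⟨hi, hiX⟩))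
  · by_cases hjL : j ∈ L
    · refine ⟨col_mem j hjL, fun k hk => ?_⟩
      have hkX : k ∈ X := by
        by_contra hkX
        exact hk (by simp [hz_row k hkX j, hx_col j hjL k])
      rw [row_mem k hkX]
      exact hlow i hi
    · rw [Finset.mem_inter] at hj
      have hiX : i ∉ X := fun hiX => hjL (mem_likedBy.2 ⟨i, hiX, hj⟩)
      rw [row_notMem i hiX] at hlt ⊢
      obtain ⟨h1, h2⟩ := hx.fair i (Finset.mem_sdiff.2 ⟨hi, hiX⟩) hlt j
        (Finset.mem_inter.2 ⟨hj.1, Finset.mem_sdiff.2 ⟨hj.2, hjL⟩⟩)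
      refine ⟨(col_notMem j hjL).trans h1, fun k hk => ?_⟩
      have hk' : x k j ≠ 0 := by simpa [hz_col j hjL k] using hk
      rw [row_notMem k (Finset.mem_sdiff.1 (hx.support k j hk').1).2]
      exact h2 k hk'
  · exact (h X hX.1 hX.2.1).trans (hlow i hi)

theorem EPSLoop.isPartialFair (h : EPSLoop u A P x) : IsPartialFair 1 u A P x := by
  induction h with
  | done P => exact isPartialFair_empty 1 u P
  | unit A P z _ hz => exact hz.isPartialFair
  | bottleneck A P X z x _ hunit hX hz _ ih =>
    exact ih.add hX.1 (hX.1.ratio_lt_one hunit).le hz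

theorem exists_epsLoop (u : Mat n) (A P : Finset (Fin n)) : ∃ x, EPSLoop u A P x := by
  induction A using Finset.strongInduction generalizing P with
  | H A ih =>
    rcases A.eq_empty_or_nonempty with rfl | hA
    · exact ⟨0, .done P⟩
    by_cases hunit : ∃ z, GivesAmount u A P 1 z
    · obtain ⟨z, hz⟩ := hunit
      exact ⟨z, .unit A P z hA hz⟩
    obtain ⟨X, hX⟩ := exists_isBottleneck u P hA
    obtain ⟨z, hz⟩ := hX.1.exists_givesAmount
    obtain ⟨x, hx⟩ := ih (A \ X) (Finset.sdiff_ssubset hX.1.1 hX.1.2.1) (P \ likedBy u X P)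
    exact ⟨z + x, .bottleneck A P X z x hA hunit hX hz hx⟩

/-- The serial loop without its one-unit exit: ratios are at most `n`, below the cap `n + 1`, so
bottleneck sets are served until no agent is left. -/
theorem exists_isPartialFair (u : Mat n) (A P : Finset (Fin n)) :
    ∃ x, IsPartialFair (n + 1) u A P x := by
  induction A using Finset.strongInduction generalizing P with
  | H A ih =>
    rcases A.eq_empty_or_nonempty with rfl | hA
    · exact ⟨0, isPartialFair_empty _ u P⟩
    obtain ⟨X, hX⟩ := exists_isBottleneck u P hA
    obtain ⟨z, hz⟩ := hX.1.exists_givesAmount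
    obtain ⟨x, hx⟩ := ih (A \ X) (Finset.sdiff_ssubset hX.1.1 hX.1.2.1) (P \ likedBy u X P)
    exact ⟨z + x, hx.add hX.1 ((ratio_le_card hX.1.2.1).trans (by linarith)) hz⟩

theorem mem_favourites (hu : Binary u) (hagent : ∀ i, ∃ j, u i j = 1) {i j : Fin n} :
    j ∈ favourites u i ↔ u i j = 1 := by
  simp only [favourites, Finset.mem_filter, Finset.mem_univ, true_and]
  refine ⟨fun h => ?_, fun h k => h ▸ hu.le_one i k⟩
  obtain ⟨k, hk⟩ := hagent i
  exact le_antisymm (hu.le_one i j) (hk ▸ h k)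

theorem IsPartialFair.utilities_eq (hu : Binary u) (hagent : ∀ i, ∃ j, u i j = 1)
    (hx : IsPartialFair c u A P x) (i : Fin n) : utilities u x i = ∑ j, x i j :=
  utilities_eq_sum hu i fun j hj => by
    by_contra h0
    have := (mem_favourites hu hagent).1 (Finset.mem_inter.1 (hx.support i j h0).2).1
    rw [hj] at this
    exact zero_ne_one this

theorem IsPartialFair.isFair (hu : Binary u) (hagent : ∀ i, ∃ j, u i j = 1)
    (hx : IsPartialFair c u Finset.univ Finset.univ x) : IsFair c u x := by
  refine ⟨hx.nonneg, fun i j hij hi => ?_⟩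
  rw [hx.utilities_eq hu hagent] at hi ⊢
  obtain ⟨h1, h2⟩ := hx.fair i (Finset.mem_univ i) hi j
    (Finset.mem_inter.2 ⟨(mem_favourites hu hagent).2 hij, Finset.mem_univ j⟩)
  refine ⟨h1, fun k hk => ⟨?_, ?_⟩⟩
  · exact (mem_favourites hu hagent).1 (Finset.mem_inter.1 (hx.support k j hk.ne').2).1
  · rw [hx.utilities_eq hu hagent]
    exact h2 k hk.ne'

end Serial

/-! ### Completion and the balancing operation -/

section Balancing

variable {n : ℕ} {u x y z : Mat n} {c : ℝ}

/-- A partial assignment with row and column sums at most one can be completed. -/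
theorem exists_balanced_ge (hy : ∀ i j, 0 ≤ y i j) (hrow : ∀ i, ∑ j, y i j ≤ 1)
    (hcol : ∀ j, ∑ i, y i j ≤ 1) : ∃ x ∈ balancedAssignments n, ∀ i j, y i j ≤ x i j := by
  set r : Fin n → ℝ := fun i => 1 - ∑ j, y i j with hr
  set s : Fin n → ℝ := fun j => 1 - ∑ i, y i j with hs
  have hr0 : ∀ i, 0 ≤ r i := fun i => sub_nonneg.2 (hrow i)
  have hs0 : ∀ j, 0 ≤ s j := fun j => sub_nonneg.2 (hcol j)
  have hrs : ∑ i, r i = ∑ j, s j := by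
    simp only [hr, hs, Finset.sum_sub_distrib]
    rw [Finset.sum_comm]
  set R := ∑ i, r i with hR
  have hR0 : 0 ≤ R := Finset.sum_nonneg fun i _ => hr0 i
  -- The missing amounts are filled by the rank-one matrix `r i * s j / R`. If `R = 0`, all deficits
  -- vanish and division by zero gives the right value 0.
  have hcancel : ∀ a : ℝ, (R = 0 → a = 0) → a * R / R = a := fun a ha => by
    by_cases h0 : R = 0
    · simp [ha h0]
    · exact mul_div_cancel_right₀ a h0
  have hzr : R = 0 → ∀ i, r i = 0 := fun h0 i =>
    (Finset.sum_eq_zero_iff_of_nonneg fun i _ => hr0 i).1 h0 i (Finset.mem_univ i)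
  have hzs : R = 0 → ∀ j, s j = 0 := fun h0 j =>
    (Finset.sum_eq_zero_iff_of_nonneg fun j _ => hs0 j).1 (hrs.symm.trans h0) j (Finset.mem_univ j)
  set x : Mat n := fun i j => y i j + r i * s j / R with hx
  have hge : ∀ i j, y i j ≤ x i j := fun i j =>
    le_add_of_nonneg_right (div_nonneg (mul_nonneg (hr0 i) (hs0 j)) hR0)
  have hx0 : ∀ i j, 0 ≤ x i j := fun i j => (hy i j).trans (hge i j)
  have hxrow : ∀ i, ∑ j, x i j = 1 := fun i => by
    simp only [hx, Finset.sum_add_distrib, ← Finset.sum_div, ← Finset.mul_sum]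
    rw [← hrs, hcancel _ fun h0 => hzr h0 i]
    simp [hr]
  have hxcol : ∀ j, ∑ i, x i j = 1 := fun j => by
    simp only [hx, Finset.sum_add_distrib, ← Finset.sum_div, ← Finset.sum_mul]
    rw [← hR, mul_comm, hcancel _ fun h0 => hzs h0 j]
    simp [hs]
  refine ⟨x, ⟨⟨fun i j => ⟨hx0 i j, ?_⟩, hxcol⟩, hxrow⟩, hge⟩
  rw [← hxrow i]
  exact Finset.single_le_sum (f := fun j => x i j) (fun j _ => hx0 i j) (Finset.mem_univ j)

theorem row_eq_of_le {a b : Fin n → ℝ} (h : ∀ j, a j ≤ b j) (hsum : ∑ j, b j ≤ ∑ j, a j) :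
    b = a :=
  funext fun j => ((Finset.sum_eq_sum_iff_of_le fun j _ => h j).1
    (le_antisymm (Finset.sum_le_sum fun j _ => h j) hsum) j (Finset.mem_univ j)).symm

/-- Fairness survives the redistribution of amounts that does not take anything from the agents
below the cap and does not bring the others below the cap. -/
theorem IsFair.transfer (hu : Binary u) (hy : IsFair 1 u y) (hx : x ∈ balancedAssignments n)
    (hlow : ∀ i, utilities u y i < 1 → ∀ j, y i j ≤ x i j)
    (hhigh : ∀ i, 1 ≤ utilities u y i → 1 ≤ utilities u x i) : IsFair 1 u x := by
  have hx0 : ∀ i j, 0 ≤ x i j := fun i j => (hx.1.1 i j).1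
  -- An item liked by an agent below 1 is fully held by agents below 1, who lose nothing; as its
  -- total remains one, its column cannot change.
  have hcol : ∀ i j, u i j = 1 → utilities u y i < 1 → ∀ k, x k j = y k j := fun i j hij hi => by
    obtain ⟨h1, h2⟩ := hy.2 i j hij hi
    refine congrFun (row_eq_of_le (a := fun k => y k j) (b := fun k => x k j) (fun k => ?_) ?_)
    · rcases (hy.1 k j).eq_or_lt with h0 | h0
      · simpa [← h0] using hx0 k j
      · exact hlow k ((h2 k h0).2.trans_lt hi) j
    · exact ((hx.1.2 j).trans h1.symm).le
  have heq : ∀ i, utilities u y i < 1 → utilities u x i = utilities u y i := fun i hi => by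
    rw [utilities_apply, utilities_apply]
    refine Finset.sum_congr rfl fun j _ => ?_
    rcases hu i j with h0 | h0
    · simp [h0]
    · rw [hcol i j h0 hi]
  refine ⟨hx0, fun i j hij hi => ⟨hx.1.2 j, fun k hk => ?_⟩⟩
  have hi' : utilities u y i < 1 := by
    by_contra h
    exact absurd (hhigh i (not_lt.1 h)) (not_le.2 hi)
  rw [hcol i j hij hi' k] at hk
  obtain ⟨h1, h2⟩ := (hy.2 i j hij hi').2 k hk
  refine ⟨h1, ?_⟩
  rw [heq i hi', heq k (h2.trans_lt hi')]
  exact h2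

theorem IsEPS.isFair (hu : Binary u) (hagent : ∀ i, ∃ j, u i j = 1) (h : IsEPS u x) :
    IsFair 1 u x := by
  obtain ⟨y, hloop, hx, hle, hkeep⟩ := h
  have hy := hloop.isPartialFair
  refine (hy.isFair hu hagent).transfer hu hx (fun i _ => hle i) fun i hi => ?_
  rw [hy.utilities_eq hu hagent] at hi
  rw [utilities_apply, hkeep i (not_lt.2 hi), ← utilities_apply, hy.utilities_eq hu hagent]
  exact hi

theorem exists_isEPS (u : Mat n) : ∃ x, IsEPS u x := by
  obtain ⟨y, hloop⟩ := exists_epsLoop u Finset.univ Finset.univ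
  have hy := hloop.isPartialFair
  obtain ⟨x, hx, hle⟩ := exists_balanced_ge hy.nonneg (fun i => hy.row_le i (Finset.mem_univ i))
    hy.column_le
  exact ⟨x, y, hloop, hx, hle, fun i hi =>
    row_eq_of_le (hle i) ((hx.2 i).trans_le (not_lt.1 hi))⟩

theorem exists_isFair_assignment (hu : Binary u) (hitem : ∀ j, ∃ i, u i j = 1)
    (hagent : ∀ i, ∃ j, u i j = 1) : ∃ x ∈ assignments n, IsFair (n + 1) u x := by
  obtain ⟨x, hx⟩ := exists_isPartialFair u Finset.univ Finset.univ
  have hfair := hx.isFair hu hagent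
  have hle : ∀ i j, x i j ≤ 1 := fun i j => (Finset.single_le_sum (f := fun i => x i j)
    (fun i _ => hx.nonneg i j) (Finset.mem_univ i)).trans (hx.column_le j)
  refine ⟨x, ⟨fun i j => ⟨hx.nonneg i j, hle i j⟩, fun j => ?_⟩, hfair⟩
  obtain ⟨i, hij⟩ := hitem j
  refine (hfair.2 i j hij ?_).1
  calc utilities u x i ≤ ∑ j, x i j := utilities_le_sum hu hx.nonneg i
    _ ≤ ∑ _j : Fin n, (1 : ℝ) := Finset.sum_le_sum fun j _ => hle i j
    _ < n + 1 := by simp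

theorem IsFair.eq_zero_of_disliked (hu : Binary u) (hitem : ∀ j, ∃ i, u i j = 1)
    (hx : IsFair (n + 1) u x) (hmem : x ∈ assignments n) {i j : Fin n} (hij : u i j = 0) :
    x i j = 0 := by
  by_contra h0
  obtain ⟨k, hk⟩ := hitem j
  have := ((hx.2 k j hk ((utilities_le_card hu hmem k).trans_lt (by linarith))).2 i
    ((hx.1 i j).lt_of_ne' h0)).1
  rw [hij] at this
  exact zero_ne_one this

theorem IsFair.mono {c' : ℝ} (hc : c' ≤ c) (hx : IsFair c u x) : IsFair c' u x :=
  ⟨hx.1, fun i j hij hi => hx.2 i j hij (hi.trans_le hc)⟩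

/-- Without a binding cap agents hold only liked items, so utility equals amount and the thresholds
of balancing are utility thresholds: `transfer` applies. -/
theorem IsFair.isFair_of_isBalancingOf (hu : Binary u) (hitem : ∀ j, ∃ i, u i j = 1)
    (hx : IsFair (n + 1) u x) (hmem : x ∈ assignments n) (h : IsBalancingOf u x y) :
    IsFair 1 u y := by
  obtain ⟨hy, hover, hunder, hexact⟩ := h
  have hrow : ∀ i, utilities u x i = ∑ j, x i j := fun i =>
    utilities_eq_sum hu i fun j hj => hx.eq_zero_of_disliked hu hitem hmem hj
  refine (hx.mono (by linarith [Nat.cast_nonneg (α := ℝ) n])).transfer hu hy (fun i hi => ?_)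
    fun i hi => ?_
  · rw [hrow] at hi
    exact hunder i hi
  · rw [hrow] at hi
    rcases hi.eq_or_lt with h1 | h1
    · rw [utilities_apply, hexact i h1.symm, ← utilities_apply, hrow]
      exact hi
    · rw [utilities_eq_sum hu i fun j hj => le_antisymm
        (((hover i h1).1 j).trans_eq (hx.eq_zero_of_disliked hu hitem hmem hj)) (hy.1.1 i j).1]
      exact (hy.2 i).ge

theorem IsFair.exists_isBalancingOf (hu : Binary u) (hitem : ∀ j, ∃ i, u i j = 1)
    (hx : IsFair (n + 1) u x) (hmem : x ∈ assignments n) : ∃ y, IsBalancingOf u x y := by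
  -- Oversized bundles are scaled down to one unit. This respects the order of giving away, because
  -- all items held are liked and hence equally preferred.
  set z : Mat n := fun i j => x i j / max 1 (∑ j, x i j) with hz
  have hmax : ∀ i, 0 < max 1 (∑ j, x i j) := fun i => lt_max_of_lt_left one_pos
  have hz0 : ∀ i j, 0 ≤ z i j := fun i j => div_nonneg (hx.1 i j) (hmax i).le
  have hzx : ∀ i j, z i j ≤ x i j := fun i j => div_le_self (hx.1 i j) (le_max_left _ _)
  have hzrow : ∀ i, ∑ j, z i j = (∑ j, x i j) / max 1 (∑ j, x i j) := fun i =>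
    (Finset.sum_div _ _ _).symm
  obtain ⟨y, hy, hzy⟩ := exists_balanced_ge hz0
    (fun i => by rw [hzrow, div_le_one (hmax i)]; exact le_max_right _ _)
    (fun j => (Finset.sum_le_sum fun i _ => hzx i j).trans_eq (hmem.2 j))
  have hkeep : ∀ i, 1 ≤ ∑ j, x i j → y i = z i := fun i hi =>
    row_eq_of_le (hzy i) (by rw [hy.2 i, hzrow, max_eq_right hi, div_self (by linarith)])
  have hsame : ∀ i, ∑ j, x i j ≤ 1 → z i = x i := fun i hi => funext fun j => by
    simp [hz, max_eq_left hi]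
  refine ⟨y, hy, fun i hi => ?_, fun i hi j => ?_, fun i hi => ?_⟩
  · rw [hkeep i hi.le]
    refine ⟨hzx i, fun j k hjk _ => ?_⟩
    have h0 : u i j = 0 := (hu i j).resolve_right fun h1 => by
      have := hu.le_one i k
      linarith
    exact le_antisymm ((hzx i j).trans_eq (hx.eq_zero_of_disliked hu hitem hmem h0)) (hz0 i j)
  · rw [← hsame i hi.le]
    exact hzy i j
  · rw [hkeep i hi.ge, hsame i hi.le]

end Balancing

/-! ### Lotteries over perfect matchings -/

section Lotteries

variable {n : ℕ} {u x : Mat n}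

theorem ofLottery_mem {w : Equiv.Perm (Fin n) → ℝ} (hw : w ∈ stdSimplex ℝ (Equiv.Perm (Fin n))) :
    ofLottery w ∈ balancedAssignments n := by
  have h0 : ∀ i j, 0 ≤ ofLottery w i j := fun i j => Finset.sum_nonneg fun σ _ => by
    split_ifs
    exacts [hw.1 σ, le_rfl]
  have hrow : ∀ i, ∑ j, ofLottery w i j = 1 := fun i => by
    simp only [ofLottery]
    rw [Finset.sum_comm]
    simpa using hw.2
  have hcol : ∀ j, ∑ i, ofLottery w i j = 1 := fun j => by
    simp only [ofLottery]
    rw [Finset.sum_comm, ← hw.2]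
    refine Finset.sum_congr rfl fun σ _ => ?_
    simp [← Equiv.eq_symm_apply]
  refine ⟨⟨fun i j => ⟨h0 i j, ?_⟩, hcol⟩, hrow⟩
  rw [← hrow i]
  exact Finset.single_le_sum (f := fun j => ofLottery w i j) (fun j _ => h0 i j)
    (Finset.mem_univ j)

/-- Birkhoff's theorem: balanced assignments are the doubly stochastic matrices. -/
theorem exists_ofLottery_eq (hx : x ∈ balancedAssignments n) :
    ∃ w ∈ stdSimplex ℝ (Equiv.Perm (Fin n)), x = ofLottery w := by
  obtain ⟨w, hw0, hw1, hw⟩ := exists_eq_sum_perm_of_mem_doublyStochastic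
    (mem_doublyStochastic_iff_sum.2 ⟨fun i j => (hx.1.1 i j).1, hx.2, hx.1.2⟩)
  refine ⟨w, ⟨hw0, hw1⟩, ?_⟩
  rw [← hw]
  ext i j
  simp [ofLottery, Matrix.sum_apply, Equiv.Perm.permMatrix, PEquiv.toMatrix_apply]

theorem acceptableProb_eq (hu : Binary u) (hagent : ∀ i, ∃ j, u i j = 1)
    (w : Equiv.Perm (Fin n) → ℝ) : acceptableProb u w = utilities u (ofLottery w) := by
  funext i
  rw [utilities_apply]
  simp only [acceptableProb, ofLottery, Finset.sum_mul]
  rw [Finset.sum_comm]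
  refine Finset.sum_congr rfl fun σ _ => ?_
  rw [Finset.sum_eq_single (σ i) (fun j _ hj => by simp [hj.symm]) (by simp)]
  simp only [mem_favourites hu hagent, if_true]
  rcases hu i (σ i) with h | h <;> simp [h]

theorem isEgalitarian_iff (hu : Binary u) (hagent : ∀ i, ∃ j, u i j = 1) :
    IsEgalitarian u x ↔ IsLeximin (balancedAssignments n) u x := by
  constructor
  · rintro ⟨w, hw, rfl, hopt⟩
    refine ⟨ofLottery_mem hw, ?_⟩
    rintro ⟨y, hy, hdom⟩
    obtain ⟨w', hw', rfl⟩ := exists_ofLottery_eq hy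
    exact hopt ⟨w', hw', by rwa [acceptableProb_eq hu hagent, acceptableProb_eq hu hagent]⟩
  · rintro ⟨hx, hopt⟩
    obtain ⟨w, hw, rfl⟩ := exists_ofLottery_eq hx
    refine ⟨w, hw, rfl, ?_⟩
    rintro ⟨w', hw', hdom⟩
    rw [acceptableProb_eq hu hagent, acceptableProb_eq hu hagent] at hdom
    exact hopt ⟨_, ofLottery_mem hw', hdom⟩

end Lotteries

/-! ### Assembling the eight rules -/

section Main

variable {n : ℕ} {u x : Mat n} {R : Mat n → Mat n → Prop}

/-- A rule with an outcome, all of whose outcomes are fair and balanced, has a single profile. -/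
theorem profiles_eq_singleton (hu : Binary u) (hx : IsFair 1 u x)
    (hmem : x ∈ balancedAssignments n) (hex : ∃ y, R u y)
    (hR : ∀ y, R u y → y ∈ balancedAssignments n ∧ IsFair 1 u y) :
    profiles R u = {utilities u x} := by
  have heq : ∀ y, R u y → utilities u y = utilities u x := fun y hy =>
    hx.eq_of_isFair hu (hR y hy).2 (capped_balancedAssignments hu) hmem (hR y hy).1
  obtain ⟨y, hy⟩ := hex
  refine Set.eq_singleton_iff_unique_mem.2 ⟨⟨y, hy, heq y hy⟩, ?_⟩
  rintro _ ⟨z, hz, rfl⟩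
  exact heq z hz

theorem profiles_thenBalance_eq_singleton (hu : Binary u) (hitem : ∀ j, ∃ i, u i j = 1)
    (hx : IsFair 1 u x) (hmem : x ∈ balancedAssignments n) (hex : ∃ y, R u y)
    (hR : ∀ y, R u y → y ∈ assignments n ∧ IsFair (n + 1) u y) :
    profiles (ThenBalance R) u = {utilities u x} := by
  refine profiles_eq_singleton hu hx hmem ?_ ?_
  · obtain ⟨y, hy⟩ := hex
    obtain ⟨z, hz⟩ := (hR y hy).2.exists_isBalancingOf hu hitem (hR y hy).1
    exact ⟨z, y, hy, hz⟩
  · rintro z ⟨y, hy, hz⟩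
    exact ⟨hz.1, (hR y hy).2.isFair_of_isBalancingOf hu hitem (hR y hy).1 hz⟩

end Main

end RandomAssignment

open RandomAssignment
theorem mainTheorem1 (n : ℕ) (u : Matrix (Fin n) (Fin n) ℝ)
    (hbinary : ∀ i j, u i j = 0 ∨ u i j = 1)
    (hitem : ∀ j, ∃ i, 0 < u i j)
    (hagent : ∀ i, ∃ j, 0 < u i j) :
    ∃ v : Fin n → ℝ,
      profiles IsHZ u = {v} ∧
      profiles IsEPS u = {v} ∧
      profiles IsEgalitarian u = {v} ∧
      profiles (IsLeximin (balancedAssignments n)) u = {v} ∧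
      profiles (IsMNW (balancedAssignments n)) u = {v} ∧
      profiles (ThenBalance (IsLeximin (assignments n))) u = {v} ∧
      profiles (ThenBalance (IsMNW (assignments n))) u = {v} ∧
      profiles (ThenBalance IsCEEI) u = {v} := by
  have hu : Binary u := hbinary
  have hone : ∀ i j, 0 < u i j → u i j = 1 := fun i j h => (hu i j).resolve_left h.ne'
  replace hitem : ∀ j, ∃ i, u i j = 1 := fun j => (hitem j).imp fun i => hone i j
  replace hagent : ∀ i, ∃ j, u i j = 1 := fun i => (hagent i).imp fun j => hone i j
  have hcap1 := capped_balancedAssignments hu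
  have hcap := capped_assignments hu
  have hpos : (0 : ℝ) < n + 1 := by positivity
  -- An EPS outcome serves as the fair balanced reference; the uncapped `y` below plays this part
  -- for the rules on all assignments.
  obtain ⟨x, hx⟩ := exists_isEPS u
  have hxm : x ∈ balancedAssignments n := hx.choose_spec.2.1
  have hxf := hx.isFair hu hagent
  obtain ⟨y, hym, hyf⟩ := exists_isFair_assignment hu hitem hagent
  have hlex : ∀ z, IsLeximin (balancedAssignments n) u z ↔ _ := fun z =>
    isLeximin_iff_isFair hu hxf hcap1 hxm
  have hmnw : ∀ z, IsMNW (balancedAssignments n) u z ↔ _ := fun z =>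
    isMNW_iff_isFair hu hagent one_pos hxf hcap1 hxm
  have hlex' : ∀ z, IsLeximin (assignments n) u z ↔ _ := fun z =>
    isLeximin_iff_isFair hu hyf hcap hym
  have hmnw' : ∀ z, IsMNW (assignments n) u z ↔ _ := fun z =>
    isMNW_iff_isFair hu hagent hpos hyf hcap hym
  refine ⟨utilities u x, ?_, ?_, ?_, ?_, ?_, ?_, ?_, ?_⟩
  · exact profiles_eq_singleton hu hxf hxm ⟨x, hxf.isHZ hu hagent hxm⟩
      fun z hz => ⟨hz.1, hz.isFair hu⟩
  · exact profiles_eq_singleton hu hxf hxm ⟨x, hx⟩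
      fun z hz => ⟨hz.choose_spec.2.1, hz.isFair hu hagent⟩
  · exact profiles_eq_singleton hu hxf hxm
      ⟨x, (isEgalitarian_iff hu hagent).2 ((hlex x).2 ⟨hxm, hxf⟩)⟩
      fun z hz => (hlex z).1 ((isEgalitarian_iff hu hagent).1 hz)
  · exact profiles_eq_singleton hu hxf hxm ⟨x, (hlex x).2 ⟨hxm, hxf⟩⟩ fun z hz => (hlex z).1 hz
  · exact profiles_eq_singleton hu hxf hxm ⟨x, (hmnw x).2 ⟨hxm, hxf⟩⟩ fun z hz => (hmnw z).1 hz
  · exact profiles_thenBalance_eq_singleton hu hitem hxf hxm ⟨y, (hlex' y).2 ⟨hym, hyf⟩⟩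
      fun z hz => (hlex' z).1 hz
  · exact profiles_thenBalance_eq_singleton hu hitem hxf hxm ⟨y, (hmnw' y).2 ⟨hym, hyf⟩⟩
      fun z hz => (hmnw' z).1 hz
  · exact profiles_thenBalance_eq_singleton hu hitem hxf hxm ⟨y, hyf.isCEEI hu hagent hym⟩
      fun z hz => ⟨hz.1, hz.isFair hu hitem _⟩
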